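/- Let $\beta>0$, let $X=L^2(0,1)$ be the complex Hilbert space, and define $L\colon D(L)\subseteq X\to X$ and $G,K\colon D(L)\to\mathbb{C}^2$ by $D(L)=H^2(0,1)$ and $$Lw=\beta w'',\qquad Gw=\begin{pmatrix}w(0)\\ w(1)\end{pmatrix},\qquad Kw=\begin{pmatrix}-\beta w'(0)\\ \beta w'(1)\end{pmatrix},\qquad w\in D(L).$$ Endow $D(L)$ with the graph norm, and let $A$ be the restriction of $L$ to $\operatorname{Ker}G$. Then: (a) $(G,L,K)$ is a boundary node on $(\mathbb{C}^2,X,\mathbb{C}^2)$, that is, $G$ and $K$ are bounded from $D(L)$ to $\mathbb{C}^2$, $A$ generates a $C_0$-semigroup on $X$, and $G$ has a bounded right inverse $G^r\colon\mathbb{C}^2\to D(L)$; and it is impedance passive, that is, $\operatorname{Re}\langle Lw,w\rangle_X\le\operatorname{Re}\langle Gw,Kw\rangle_{\mathbb{C}^2}$ for all $w\in D(L)$. (b) The semigroup $(T(t))_{t\ge0}$ generated by $A$ is uniformly exponentially stable, that is, there are $M,c>0$ such that $\|T(t)\|\le Me^{-ct}$ for all $t\ge0$. (c) The map $w\mapsto(Gw,Kw)$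 from $D(L)$ to $\mathbb{C}^4$ is surjective. (d) Let $P\colon\rho(A)\to\mathcal{B}(\mathbb{C}^2)$ be the transfer function of $(G,L,K)$, that is, $P(\lambda)u=Kw$, where $w\in D(L)$ is the unique solution of $(\lambda-L)w=0$, $Gw=u$. The closed half-plane $\{\lambda\in\mathbb{C}:\operatorname{Re}\lambda\ge0\}$ is contained in the resolvent set $\rho(A)$, and for all $\lambda$ in it $$P(\lambda)=\begin{pmatrix}p_1(\lambda)&p_2(\lambda)\\ p_2(\lambda)&p_1(\lambda)\end{pmatrix},$$ where, for $\lambda\neq0$ and with the principal branch of the square root, $$p_1(\lambda)=\frac{\sqrt{\lambda\beta}}{\tanh\sqrt{\lambda/\beta}},\qquad p_2(\lambda)=-\frac{\sqrt{\lambda\beta}}{\sinh\sqrt{\lambda/\beta}},$$ and $p_1(0)=-p_2(0)=\beta$. -/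

import Mathlib

open MeasureTheory Set Filter Topology
open scoped ContDiff NNReal

noncomputable section

/-! ### Strongly continuous semigroups, generators, resolvent sets -/

section Semigroups

variable {X : Type*} [NormedAddCommGroup X] [NormedSpace ℂ X]

/-- A `C₀`-semigroup of bounded linear operators on `X`. -/
structure C0Semigroup (X : Type*) [NormedAddCommGroup X] [NormedSpace ℂ X] where
  toFun : ℝ≥0 → X →L[ℂ] X
  map_zero : toFun 0 = ContinuousLinearMap.id ℂ X
  map_add : ∀ s t, toFun (s + t) = (toFun s).comp (toFun t)
  tendsto_zero : ∀ x, Tendsto (fun t => toFun t x) (𝓝 0) (𝓝 x)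

/-- `A` is the (infinitesimal) generator of `T`: `x` lies in `D(A)` with `A x = y` if and only if
the difference quotients `(T(t)x - x)/t` converge to `y` as `t → 0+`. -/
def C0Semigroup.IsGeneratedBy (T : C0Semigroup X) (A : X →ₗ.[ℂ] X) : Prop :=
  ∀ x y : X, (∃ h : x ∈ A.domain, A ⟨x, h⟩ = y) ↔
    Tendsto (fun t : ℝ≥0 => (((t : ℝ) : ℂ)⁻¹) • (T.toFun t x - x)) (𝓝[>] 0) (𝓝 y)

/-- Uniform exponential stability: `‖T(t)‖ ≤ M e^{-c t}` for all `t ≥ 0`, for some `M` and some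
`c > 0`. -/
def C0Semigroup.IsUniformlyExponentiallyStable (T : C0Semigroup X) : Prop :=
  ∃ M c : ℝ, 0 < c ∧ ∀ t : ℝ≥0, ‖T.toFun t‖ ≤ M * Real.exp (-c * t)

/-- The resolvent set `ρ(A)` of an unbounded operator: all `z` for which `z - A : D(A) → X` has
a bounded everywhere defined two-sided inverse. -/
def operatorResolventSet (A : X →ₗ.[ℂ] X) : Set ℂ :=
  {z | ∃ R : X →L[ℂ] X,
    (∀ y : X, ∃ x : A.domain, (x : X) = R y ∧ z • (x : X) - A x = y) ∧
    ∀ x : A.domain, R (z • (x : X) - A x) = x}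

end Semigroups

/-! ### Boundary nodes -/

section BoundaryNodes

variable {X U : Type*} [NormedAddCommGroup X] [InnerProductSpace ℂ X] [CompleteSpace X]
  [NormedAddCommGroup U] [InnerProductSpace ℂ U] [CompleteSpace U]

/-- The restriction of `L` to the kernel of `G : D(L) → U`. -/
def restrictKer (L : X →ₗ.[ℂ] X) (G : L.domain →ₗ[ℂ] U) : X →ₗ.[ℂ] X :=
  L.domRestrict ((LinearMap.ker G).map L.domain.subtype)

/-- The graph norm on `D(L)`. -/
def graphNorm (L : X →ₗ.[ℂ] X) (x : L.domain) : ℝ := ‖(x : X)‖ + ‖L x‖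

/-- `(G, L, K)` is a boundary node on `(U, X, U)`; boundedness refers to the graph norm
of `D(L)`. -/
structure IsBoundaryNode (L : X →ₗ.[ℂ] X) (G K : L.domain →ₗ[ℂ] U) : Prop where
  bounded_G : ∃ C : ℝ, ∀ x : L.domain, ‖G x‖ ≤ C * graphNorm L x
  bounded_K : ∃ C : ℝ, ∀ x : L.domain, ‖K x‖ ≤ C * graphNorm L x
  generates : ∃ T : C0Semigroup X, T.IsGeneratedBy (restrictKer L G)
  rightInverse : ∃ Gr : U →ₗ[ℂ] L.domain,
    (∃ C : ℝ, ∀ u : U, graphNorm L (Gr u) ≤ C * ‖u‖) ∧ ∀ u : U, G (Gr u) = u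

/-- Impedance passivity of a boundary node `(G, L, K)`: `Re ⟨Lx, x⟩ ≤ Re ⟨Gx, Kx⟩` for all
`x ∈ D(L)`. -/
def IsImpedancePassive (L : X →ₗ.[ℂ] X) (G K : L.domain →ₗ[ℂ] U) : Prop :=
  ∀ x : L.domain, (inner ℂ (L x) (x : X)).re ≤ (inner ℂ (G x) (K x)).re

/-- For `z ∈ ρ(A)`, the abstract elliptic problem `(z - L) x = 0`, `G x = u` is uniquely
solvable. -/
theorem IsBoundaryNode.existsUnique_elliptic {L : X →ₗ.[ℂ] X} {G K : L.domain →ₗ[ℂ] U}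
    (h : IsBoundaryNode L G K) {z : ℂ} (hz : z ∈ operatorResolventSet (restrictKer L G)) (u : U) :
    ∃! x : L.domain, z • (x : X) - L x = 0 ∧ G x = u := by
  obtain ⟨R, hR1, hR2⟩ := hz
  obtain ⟨Gr, -, hGr⟩ := h.rightInverse
  obtain ⟨x, -, hx⟩ := hR1 (z • (Gr u : X) - L (Gr u))
  obtain ⟨x', hx'⟩ : ∃ x' : L.domain, (x' : X) = x ∧ G x' = 0 := by
    obtain ⟨y, hy, hyx⟩ := x.2.1
    exact ⟨y, hyx, hy⟩
  have hLx : restrictKer L G x = L x' := LinearPMap.domRestrict_apply (f := L) hx'.1.symm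
  refine ⟨Gr u - x', ⟨?_, ?_⟩, ?_⟩
  · rw [hLx, ← hx'.1] at hx
    rw [LinearPMap.map_sub, Submodule.coe_sub, smul_sub]
    rw [sub_sub_sub_comm, hx, sub_self]
  · rw [map_sub, hGr, hx'.2, sub_zero]
  · rintro y ⟨hy1, hy2⟩
    have hG : G (y - (Gr u - x')) = 0 := by
      rw [map_sub, map_sub, hy2, hGr, hx'.2]; simp
    set w : L.domain := y - (Gr u - x') with hw
    let w' : (restrictKer L G).domain := ⟨(w : X), ⟨w, hG, rfl⟩, w.2⟩
    have hLw : restrictKer L G w' = L w := LinearPMap.domRestrict_apply (f := L) rfl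
    have h0 : z • (w' : X) - restrictKer L G w' = 0 := by
      rw [hLw]
      change z • (w : X) - L w = 0
      rw [hLx, ← hx'.1] at hx
      rw [hw, LinearPMap.map_sub, LinearPMap.map_sub, Submodule.coe_sub, Submodule.coe_sub,
        smul_sub, smul_sub, sub_sub_sub_comm, hy1, sub_sub_sub_comm, hx]
      simp
    have h1 := hR2 w'
    rw [h0, map_zero] at h1
    have h2 : w = 0 := Subtype.ext h1.symm
    exact sub_eq_zero.mp h2

/-- The bounded operator `P(z)`, for `z ∈ ρ(A)`, exists. -/
theorem IsBoundaryNode.exists_transfer {L : X →ₗ.[ℂ] X} {G K : L.domain →ₗ[ℂ] U}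
    (h : IsBoundaryNode L G K) {z : ℂ} (hz : z ∈ operatorResolventSet (restrictKer L G)) :
    ∃ P : U →L[ℂ] U, ∀ (u : U) (x : L.domain), z • (x : X) - L x = 0 → G x = u → P u = K x := by
  have hu := fun u => h.existsUnique_elliptic hz u
  obtain ⟨R, hR1, hR2⟩ := id hz
  obtain ⟨Gr, ⟨C, hC⟩, hGr⟩ := h.rightInverse
  obtain ⟨C', hC'⟩ := h.bounded_K
  choose S hS hSu using hu
  have hadd : ∀ u v, S (u + v) = S u + S v := fun u v => by
    refine (hSu (u + v) _ ⟨?_, ?_⟩).symm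
    · rw [LinearPMap.map_add, Submodule.coe_add, smul_add, add_sub_add_comm, (hS u).1, (hS v).1,
        add_zero]
    · rw [map_add, (hS u).2, (hS v).2]
  have hsmul : ∀ (c : ℂ) u, S (c • u) = c • S u := fun c u => by
    refine (hSu (c • u) _ ⟨?_, ?_⟩).symm
    · rw [LinearPMap.map_smul, Submodule.coe_smul, smul_comm, ← smul_sub, (hS u).1, smul_zero]
    · rw [map_smul, (hS u).2]
  have hnorm : ∀ u, ‖(S u : X)‖ ≤ (C + ‖R‖ * ((‖z‖ + 1) * C)) * ‖u‖ := fun u => by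
    have hG : G (S u - Gr u) = 0 := by rw [map_sub, (hS u).2, hGr, sub_self]
    let w' : (restrictKer L G).domain := ⟨((S u - Gr u : L.domain) : X), ⟨_, hG, rfl⟩, Subtype.prop _⟩
    have hLw : restrictKer L G w' = L (S u - Gr u) := LinearPMap.domRestrict_apply (f := L) rfl
    have h1 := hR2 w'
    have h2 : z • (w' : X) - restrictKer L G w' = -(z • (Gr u : X) - L (Gr u)) := by
      rw [hLw]
      change z • ((S u - Gr u : L.domain) : X) - L (S u - Gr u) = _
      rw [LinearPMap.map_sub, Submodule.coe_sub, smul_sub, sub_sub_sub_comm, (hS u).1, zero_sub]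
    rw [h2] at h1
    have h3 : (S u : X) = (Gr u : X) + R (-(z • (Gr u : X) - L (Gr u))) := by
      rw [h1]; change _ = _ + ((S u - Gr u : L.domain) : X); simp
    have hg := hC u
    unfold graphNorm at hg
    have a1 : ‖(Gr u : X)‖ ≤ C * ‖u‖ := by linarith [norm_nonneg (L (Gr u))]
    have a2 : ‖L (Gr u)‖ ≤ C * ‖u‖ := by linarith [norm_nonneg (Gr u : X)]
    have a3 : ‖-(z • (Gr u : X) - L (Gr u))‖ ≤ (‖z‖ + 1) * C * ‖u‖ := by
      rw [norm_neg]
      refine (norm_sub_le _ _).trans ?_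
      rw [norm_smul]
      nlinarith [mul_le_mul_of_nonneg_left a1 (norm_nonneg z)]
    rw [h3]
    refine (norm_add_le _ _).trans ?_
    have a4 := (R.le_opNorm (-(z • (Gr u : X) - L (Gr u)))).trans
      (mul_le_mul_of_nonneg_left a3 (norm_nonneg R))
    linarith
  let F : U →ₗ[ℂ] U :=
    { toFun := fun u => K (S u)
      map_add' := fun u v => by rw [hadd, map_add]
      map_smul' := fun c u => by rw [hsmul, map_smul, RingHom.id_apply] }
  refine ⟨F.mkContinuous (|C'| * ((1 + ‖z‖) * (C + ‖R‖ * ((‖z‖ + 1) * C)))) fun u => ?_, ?_⟩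
  · have hL : L (S u) = z • (S u : X) := (sub_eq_zero.mp (hS u).1).symm
    have hg : graphNorm L (S u) = (1 + ‖z‖) * ‖(S u : X)‖ := by
      unfold graphNorm; rw [hL, norm_smul]; ring
    have hg0 : 0 ≤ graphNorm L (S u) := by unfold graphNorm; positivity
    calc ‖K (S u)‖ ≤ C' * graphNorm L (S u) := hC' _
      _ ≤ |C'| * graphNorm L (S u) := mul_le_mul_of_nonneg_right (le_abs_self _) hg0
      _ ≤ |C'| * ((1 + ‖z‖) * ((C + ‖R‖ * ((‖z‖ + 1) * C)) * ‖u‖)) := by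
        rw [hg]; gcongr; exact hnorm u
      _ = _ := by ring
  · intro u x hx hxu
    change K (S u) = K x
    rw [hSu u x ⟨hx, hxu⟩]

/-- The transfer function `P : ρ(A) → B(U)` of a boundary node: `P(z) u = K x`, where `x ∈ D(L)`
is the unique solution of `(z - L) x = 0`, `G x = u`. -/
def IsBoundaryNode.transferFunction {L : X →ₗ.[ℂ] X} {G K : L.domain →ₗ[ℂ] U}
    (h : IsBoundaryNode L G K) (z : operatorResolventSet (restrictKer L G)) : U →L[ℂ] U :=
  (h.exists_transfer z.2).choose

theorem IsBoundaryNode.transferFunction_apply {L : X →ₗ.[ℂ] X} {G K : L.domain →ₗ[ℂ] U}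
    (h : IsBoundaryNode L G K) (z : operatorResolventSet (restrictKer L G)) (u : U)
    (x : L.domain) (hx : (z : ℂ) • (x : X) - L x = 0) (hu : G x = u) :
    h.transferFunction z u = K x :=
  (h.exists_transfer z.2).choose_spec u x hx hu

end BoundaryNodes

/-! ### The Sobolev spaces `H¹(0,1)` and `H²(0,1)` -/

section Sobolev

/-- The complex Hilbert space `L²(0,1)`. -/
abbrev L2Unit : Type := Lp ℂ 2 (volume.restrict (Ioo (0 : ℝ) 1))

/-- `g` is the weak derivative of `f` on `(0,1)`. -/
def IsWeakDeriv (f g : L2Unit) : Prop :=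
  ∀ φ : ℝ → ℝ, ContDiff ℝ ∞ φ → HasCompactSupport φ → tsupport φ ⊆ Ioo 0 1 →
    ∫ x in Ioo (0 : ℝ) 1, deriv φ x • f x = -∫ x in Ioo (0 : ℝ) 1, φ x • g x

/-- `F ∈ C[0,1]` is a continuous representative of `f`. -/
def IsContRep (f : L2Unit) (F : C(Icc (0 : ℝ) 1, ℂ)) : Prop :=
  ∀ᵐ x ∂volume.restrict (Ioo (0 : ℝ) 1), f x = IccExtend zero_le_one F x

theorem L2Unit.integrable (f : L2Unit) : Integrable f (volume.restrict (Ioo (0 : ℝ) 1)) :=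
  (Lp.memLp f).integrable (by norm_num)

theorem integrable_smul_of_contDiff {φ : ℝ → ℝ} (hc : Continuous φ) (hs : HasCompactSupport φ)
    {f : ℝ → ℂ} (hf : Integrable f (volume.restrict (Ioo (0 : ℝ) 1))) :
    Integrable (fun x => φ x • f x) (volume.restrict (Ioo (0 : ℝ) 1)) := by
  obtain ⟨C, hC⟩ := hs.exists_bound_of_continuous hc
  exact hf.bdd_smul C hc.aestronglyMeasurable (Eventually.of_forall hC)

theorem IsWeakDeriv.unique {f g₁ g₂ : L2Unit} (h₁ : IsWeakDeriv f g₁) (h₂ : IsWeakDeriv f g₂) :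
    g₁ = g₂ := by
  have hint : Integrable (fun x => g₁ x - g₂ x) (volume.restrict (Ioo (0 : ℝ) 1)) :=
    g₁.integrable.sub g₂.integrable
  have key := isOpen_Ioo.ae_eq_zero_of_integral_contDiff_smul_eq_zero (μ := volume)
    (U := Ioo (0 : ℝ) 1) (f := fun x => g₁ x - g₂ x) (IntegrableOn.locallyIntegrableOn hint) ?_
  · refine Lp.ext ?_
    filter_upwards [(ae_restrict_iff' measurableSet_Ioo).2 key] with x hx
    exact sub_eq_zero.mp hx
  · intro φ hφ hc hs
    have hz : ∫ x in Ioo (0 : ℝ) 1, φ x • (g₁ x - g₂ x) = 0 := by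
      simp_rw [smul_sub]
      rw [integral_sub (integrable_smul_of_contDiff hφ.continuous hc g₁.integrable)
        (integrable_smul_of_contDiff hφ.continuous hc g₂.integrable), sub_eq_zero]
      exact neg_injective ((h₁ φ hφ hc hs).symm.trans (h₂ φ hφ hc hs))
    rw [← hz, eq_comm]
    refine setIntegral_eq_integral_of_forall_compl_eq_zero fun x hx => ?_
    rw [image_eq_zero_of_notMem_tsupport fun h => hx (hs h), zero_smul]

theorem IsWeakDeriv.add {f₁ f₂ g₁ g₂ : L2Unit} (h₁ : IsWeakDeriv f₁ g₁) (h₂ : IsWeakDeriv f₂ g₂) :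
    IsWeakDeriv (f₁ + f₂) (g₁ + g₂) := by
  intro φ hφ hc hs
  have e1 : (fun x => deriv φ x • (f₁ + f₂ : L2Unit) x) =ᵐ[volume.restrict (Ioo (0 : ℝ) 1)]
      fun x => deriv φ x • f₁ x + deriv φ x • f₂ x := by
    filter_upwards [Lp.coeFn_add f₁ f₂] with x hx
    rw [hx, Pi.add_apply, smul_add]
  have e2 : (fun x => φ x • (g₁ + g₂ : L2Unit) x) =ᵐ[volume.restrict (Ioo (0 : ℝ) 1)]
      fun x => φ x • g₁ x + φ x • g₂ x := by
    filter_upwards [Lp.coeFn_add g₁ g₂] with x hx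
    rw [hx, Pi.add_apply, smul_add]
  have hd : Continuous (deriv φ) := hφ.continuous_deriv (by simp)
  rw [integral_congr_ae e1, integral_congr_ae e2,
    integral_add (integrable_smul_of_contDiff hd hc.deriv f₁.integrable)
      (integrable_smul_of_contDiff hd hc.deriv f₂.integrable),
    integral_add (integrable_smul_of_contDiff hφ.continuous hc g₁.integrable)
      (integrable_smul_of_contDiff hφ.continuous hc g₂.integrable),
    h₁ φ hφ hc hs, h₂ φ hφ hc hs, neg_add]

theorem IsWeakDeriv.smul {f g : L2Unit} (c : ℂ) (h : IsWeakDeriv f g) :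
    IsWeakDeriv (c • f) (c • g) := by
  intro φ hφ hc hs
  have e1 : (fun x => deriv φ x • (c • f : L2Unit) x) =ᵐ[volume.restrict (Ioo (0 : ℝ) 1)]
      fun x => c • (deriv φ x • f x) := by
    filter_upwards [Lp.coeFn_smul c f] with x hx
    rw [hx, Pi.smul_apply, smul_comm]
  have e2 : (fun x => φ x • (c • g : L2Unit) x) =ᵐ[volume.restrict (Ioo (0 : ℝ) 1)]
      fun x => c • (φ x • g x) := by
    filter_upwards [Lp.coeFn_smul c g] with x hx
    rw [hx, Pi.smul_apply, smul_comm]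
  rw [integral_congr_ae e1, integral_congr_ae e2, integral_smul, integral_smul, h φ hφ hc hs,
    smul_neg]

theorem IsWeakDeriv.zero : IsWeakDeriv 0 0 := by
  intro φ _ _ _
  have e : ∀ ψ : ℝ → ℝ, ∫ x in Ioo (0 : ℝ) 1, ψ x • (0 : L2Unit) x = 0 := fun ψ => by
    refine (integral_congr_ae (g := fun _ => (0 : ℂ)) ?_).trans (by simp)
    filter_upwards [Lp.coeFn_zero ℂ 2 (volume.restrict (Ioo (0 : ℝ) 1))] with x hx
    rw [hx]; simp
  rw [e, e, neg_zero]

/-- The Sobolev space `H¹(0,1)`. -/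
def sobolevH1 : Submodule ℂ L2Unit where
  carrier := {f | ∃ g, IsWeakDeriv f g}
  add_mem' := fun ⟨_, h₁⟩ ⟨_, h₂⟩ => ⟨_, h₁.add h₂⟩
  zero_mem' := ⟨0, IsWeakDeriv.zero⟩
  smul_mem' := fun c _ ⟨_, h⟩ => ⟨_, h.smul c⟩

/-- The weak derivative `H¹(0,1) → L²(0,1)`. -/
def weakDeriv : sobolevH1 →ₗ[ℂ] L2Unit where
  toFun f := f.2.choose
  map_add' f g := (f + g).2.choose_spec.unique (f.2.choose_spec.add g.2.choose_spec)
  map_smul' c f := (c • f).2.choose_spec.unique (f.2.choose_spec.smul c)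

theorem isWeakDeriv_weakDeriv (f : sobolevH1) : IsWeakDeriv f (weakDeriv f) := f.2.choose_spec

/-- The Sobolev space `H²(0,1)`. -/
def sobolevH2 : Submodule ℂ L2Unit where
  carrier := {f | ∃ g h, IsWeakDeriv f g ∧ IsWeakDeriv g h}
  add_mem' := fun ⟨_, _, h₁, k₁⟩ ⟨_, _, h₂, k₂⟩ => ⟨_, _, h₁.add h₂, k₁.add k₂⟩
  zero_mem' := ⟨0, 0, IsWeakDeriv.zero, IsWeakDeriv.zero⟩
  smul_mem' := fun c _ ⟨_, _, h, k⟩ => ⟨_, _, h.smul c, k.smul c⟩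

theorem sobolevH2_le : sobolevH2 ≤ sobolevH1 := fun _ ⟨g, _, h, _⟩ => ⟨g, h⟩

/-- The inclusion `H²(0,1) → H¹(0,1)`. -/
def sobolevIncl : sobolevH2 →ₗ[ℂ] sobolevH1 := Submodule.inclusion sobolevH2_le

/-- The derivative `w ↦ w'`, `H²(0,1) → H¹(0,1)`. -/
def sobolevDeriv : sobolevH2 →ₗ[ℂ] sobolevH1 :=
  (weakDeriv.comp sobolevIncl).codRestrict sobolevH1 fun f => by
    obtain ⟨g, k, h₁, h₂⟩ := f.2
    have : weakDeriv (sobolevIncl f) = g := (isWeakDeriv_weakDeriv (sobolevIncl f)).unique h₁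
    exact ⟨k, by rw [LinearMap.comp_apply, this]; exact h₂⟩

theorem integral_deriv_smul_primitive {g : ℝ → ℂ}
    (hg : Integrable g (volume.restrict (Ioo (0 : ℝ) 1))) {φ : ℝ → ℝ} (hφ : ContDiff ℝ ∞ φ)
    (hc : HasCompactSupport φ) (hs : tsupport φ ⊆ Ioo 0 1) :
    ∫ x in Ioo (0 : ℝ) 1, deriv φ x • (∫ t in Ioo (0 : ℝ) 1, (Iio x).indicator g t) =
      -∫ x in Ioo (0 : ℝ) 1, φ x • g x := by
  have hd : Continuous (deriv φ) := hφ.continuous_deriv (by simp)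
  have hdi : Integrable (deriv φ) (volume.restrict (Ioo (0 : ℝ) 1)) :=
    (hd.integrable_of_hasCompactSupport hc.deriv).restrict
  have hint : Integrable (fun p : ℝ × ℝ => deriv φ p.1 • (Iio p.1).indicator g p.2)
      ((volume.restrict (Ioo (0 : ℝ) 1)).prod (volume.restrict (Ioo (0 : ℝ) 1))) := by
    have h1 := (hdi.smul_prod hg).indicator (s := {p : ℝ × ℝ | p.2 < p.1})
      (measurableSet_lt measurable_snd measurable_fst)
    refine h1.congr (Eventually.of_forall fun p => ?_)
    by_cases h : p.2 < p.1 <;> simp [indicator, h]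
  simp_rw [← integral_smul]
  rw [integral_integral_swap hint, ← integral_neg]
  refine setIntegral_congr_fun measurableSet_Ioo fun t ht => ?_
  have h2 : ∀ x, deriv φ x • (Iio x).indicator g t = (Ioi t).indicator (deriv φ) x • g t := by
    intro x
    by_cases h : t < x <;> simp [indicator, h]
  simp_rw [h2]
  rw [integral_smul_const, setIntegral_indicator measurableSet_Ioi]
  have h3 : Ioo (0 : ℝ) 1 ∩ Ioi t = Ioo t 1 := by
    ext x; simp only [mem_inter_iff, mem_Ioo, mem_Ioi]
    exact ⟨fun h => ⟨h.2, h.1.2⟩, fun h => ⟨⟨ht.1.trans h.1, h.2⟩, h.1⟩⟩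
  have h4 : ∫ x in t..1, deriv φ x = φ 1 - φ t :=
    intervalIntegral.integral_deriv_eq_sub (fun x _ => (hφ.differentiable (by simp)) x)
      (hd.intervalIntegrable _ _)
  have h5 : φ 1 = 0 := image_eq_zero_of_notMem_tsupport fun h => by simpa using hs h
  rw [h3, ← integral_Ioc_eq_integral_Ioo, ← intervalIntegral.integral_of_le ht.2.le, h4, h5,
    zero_sub, neg_smul]

/-- An integrable function on `(0,1)` with vanishing distributional derivative is constant. -/
theorem ae_eq_const_of_integral_deriv {f : ℝ → ℂ}
    (hf : Integrable f (volume.restrict (Ioo (0 : ℝ) 1)))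
    (h : ∀ φ : ℝ → ℝ, ContDiff ℝ ∞ φ → HasCompactSupport φ → tsupport φ ⊆ Ioo 0 1 →
      ∫ x in Ioo (0 : ℝ) 1, deriv φ x • f x = 0) :
    ∃ c : ℂ, ∀ᵐ x ∂volume.restrict (Ioo (0 : ℝ) 1), f x = c := by
  obtain ⟨ρ₀, hρs, hρc, hρd, hρr, hρ1⟩ := exists_contDiff_tsupport_subset (n := ⊤)
    (Ioo_mem_nhds (show (0 : ℝ) < 1 / 2 by norm_num) (show (1 / 2 : ℝ) < 1 by norm_num))
  have hρpos : 0 < ∫ x, ρ₀ x :=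
    hρd.continuous.integral_pos_of_hasCompactSupport_nonneg_nonzero hρc
      (fun x => (hρr (mem_range_self x)).1) (x := 1 / 2) (by rw [hρ1]; norm_num)
  have supp_int : ∀ ψ : ℝ → ℝ, tsupport ψ ⊆ Ioo 0 1 → ∫ x in Ioo (0 : ℝ) 1, ψ x = ∫ x, ψ x :=
    fun ψ hψ => setIntegral_eq_integral_of_forall_compl_eq_zero fun x hx =>
      image_eq_zero_of_notMem_tsupport fun hh => hx (hψ hh)
  -- test functions of mean zero are derivatives of test functions
  have prim : ∀ ψ : ℝ → ℝ, ContDiff ℝ ∞ ψ → HasCompactSupport ψ → tsupport ψ ⊆ Ioo 0 1 →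
      ∫ x, ψ x = 0 → ∫ x in Ioo (0 : ℝ) 1, ψ x • f x = 0 := by
    intro ψ hψ hψc hψs hψ0
    by_cases hne : (tsupport ψ).Nonempty
    swap
    · have : ∀ x, ψ x = 0 := fun x =>
        image_eq_zero_of_notMem_tsupport fun hh => hne ⟨x, hh⟩
      simp [this]
    obtain ⟨a, ha, ha'⟩ := (show IsCompact (tsupport ψ) from hψc).exists_isLeast hne
    obtain ⟨b, hb, hb'⟩ := (show IsCompact (tsupport ψ) from hψc).exists_isGreatest hne
    set Φ : ℝ → ℝ := fun x => ∫ t in a..x, ψ t with hΦ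
    have hder : ∀ x, HasDerivAt Φ (ψ x) x := fun x =>
      intervalIntegral.integral_hasDerivAt_right (hψ.continuous.intervalIntegrable _ _)
        (hψ.continuous.stronglyMeasurableAtFilter _ _) hψ.continuous.continuousAt
    have hderiv : deriv Φ = ψ := funext fun x => (hder x).deriv
    have hΦd : ContDiff ℝ ∞ Φ := contDiff_infty_iff_deriv.2
      ⟨fun x => (hder x).differentiableAt, by rw [hderiv]; exact hψ⟩
    have zero_of : ∀ x, (x < a ∨ b < x) → ψ x = 0 := fun x hx =>
      image_eq_zero_of_notMem_tsupport fun hh =>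
        hx.elim (fun h1 => absurd (ha' hh) (not_le.2 h1)) fun h1 => absurd (hb' hh) (not_le.2 h1)
    have hsup : Function.support Φ ⊆ Icc a b := by
      intro x hx
      by_contra hcon
      apply hx
      rcases lt_or_ge x a with hxa | hxa
      · rw [hΦ]
        simp only
        rw [intervalIntegral.integral_symm, intervalIntegral.integral_of_le hxa.le,
          integral_Ioc_eq_integral_Ioo, neg_eq_zero]
        exact setIntegral_eq_zero_of_forall_eq_zero fun t ht => zero_of t (Or.inl ht.2)
      · have hxb : b < x := by
          by_contra hh
          exact hcon ⟨hxa, not_lt.1 hh⟩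
        rw [hΦ]
        simp only
        rw [intervalIntegral.integral_of_le hxa, ← integral_Icc_eq_integral_Ioc, ← hψ0]
        refine setIntegral_eq_integral_of_forall_compl_eq_zero fun t ht => zero_of t ?_
        by_contra hh
        push Not at hh
        exact ht ⟨hh.1, hh.2.trans hxb.le⟩
    have hts : tsupport Φ ⊆ Icc a b := closure_minimal hsup isClosed_Icc
    have := h Φ hΦd (isCompact_Icc.of_isClosed_subset (isClosed_tsupport _) hts)
      (hts.trans fun x hx => ⟨(hψs ha).1.trans_le hx.1, hx.2.trans_lt (hψs hb).2⟩)
    rwa [hderiv] at this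
  set m : ℝ := ∫ x, ρ₀ x with hm
  set ρ : ℝ → ℝ := fun x => m⁻¹ * ρ₀ x with hρdef
  have ρsub : Function.support ρ ⊆ Function.support ρ₀ := fun x hx hx0 => hx (by
    simp only [hρdef]; rw [hx0, mul_zero])
  have ρd : ContDiff ℝ ∞ ρ := contDiff_const.mul hρd
  have ρc : HasCompactSupport ρ := hρc.mono ρsub
  have ρs : tsupport ρ ⊆ Ioo 0 1 := (closure_mono ρsub).trans hρs
  have ρint : ∫ x, ρ x = 1 := by
    simp only [hρdef]
    rw [integral_const_mul, ← hm, inv_mul_cancel₀ hρpos.ne']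
  set c : ℂ := ∫ x in Ioo (0 : ℝ) 1, ρ x • f x with hcdef
  refine ⟨c, ?_⟩
  have hint : Integrable (fun x => f x - c) (volume.restrict (Ioo (0 : ℝ) 1)) :=
    hf.sub (integrable_const c)
  have key := isOpen_Ioo.ae_eq_zero_of_integral_contDiff_smul_eq_zero (μ := volume)
    (U := Ioo (0 : ℝ) 1) (f := fun x => f x - c) (IntegrableOn.locallyIntegrableOn hint) ?_
  · filter_upwards [(ae_restrict_iff' measurableSet_Ioo).2 key] with x hx
    exact sub_eq_zero.mp hx
  · intro η hη hηc hηs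
    set J : ℝ := ∫ x, η x with hJ
    have ηi : Integrable η := hη.continuous.integrable_of_hasCompactSupport hηc
    have ρi : Integrable ρ := ρd.continuous.integrable_of_hasCompactSupport ρc
    have hsupp : tsupport (fun x => η x - J * ρ x) ⊆ tsupport η ∪ tsupport ρ := by
      refine closure_minimal (fun x hx => ?_)
        ((isClosed_tsupport η).union (isClosed_tsupport ρ))
      by_contra hh
      rw [mem_union, not_or] at hh
      exact hx (by simp only; rw [image_eq_zero_of_notMem_tsupport hh.1,
        image_eq_zero_of_notMem_tsupport hh.2]; simp)
    have h0 := prim (fun x => η x - J * ρ x) (hη.sub (contDiff_const.mul ρd))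
      ((IsCompact.union hηc ρc).of_isClosed_subset (isClosed_tsupport _) hsupp)
      (hsupp.trans (union_subset hηs ρs))
      (by rw [integral_sub ηi (ρi.const_mul J), integral_const_mul, ρint, mul_one, sub_self])
    have h1 : ∫ x in Ioo (0 : ℝ) 1, (η x - J * ρ x) • f x =
        (∫ x in Ioo (0 : ℝ) 1, η x • f x) - J • c := by
      simp_rw [sub_smul, mul_smul]
      have hi : Integrable (fun x => J • ρ x • f x) (volume.restrict (Ioo (0 : ℝ) 1)) :=
        (integrable_smul_of_contDiff ρd.continuous ρc hf).smul J
      rw [integral_sub (integrable_smul_of_contDiff hη.continuous hηc hf) hi, integral_smul]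
    have h2 : ∫ x in Ioo (0 : ℝ) 1, η x • (f x - c) =
        (∫ x in Ioo (0 : ℝ) 1, η x • f x) - J • c := by
      simp_rw [smul_sub]
      rw [integral_sub (integrable_smul_of_contDiff hη.continuous hηc hf)
        (integrable_smul_of_contDiff hη.continuous hηc (integrable_const c)),
        integral_smul_const, supp_int η hηs]
    rw [← h0, h1, ← h2, eq_comm]
    refine setIntegral_eq_integral_of_forall_compl_eq_zero fun x hx => ?_
    rw [image_eq_zero_of_notMem_tsupport fun hh => hx (hηs hh), zero_smul]

theorem IsWeakDeriv.exists_contRep {f g : L2Unit} (h : IsWeakDeriv f g) :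
    ∃ F : C(Icc (0 : ℝ) 1, ℂ), IsContRep f F := by
  have hcont : ContinuousOn (fun x => ∫ t in (0 : ℝ)..x, g t) (Icc 0 1) := by
    have := intervalIntegral.continuousOn_primitive_interval (μ := volume) (f := g) (a := 0)
      (b := 1) (by rw [uIcc_of_le zero_le_one, integrableOn_Icc_iff_integrableOn_Ioo]
                   exact g.integrable)
    rwa [uIcc_of_le zero_le_one] at this
  have heq : ∀ x ∈ Ioo (0 : ℝ) 1, ∫ t in Ioo (0 : ℝ) 1, (Iio x).indicator g t =
      ∫ t in (0 : ℝ)..x, g t := by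
    intro x hx
    rw [setIntegral_indicator measurableSet_Iio, intervalIntegral.integral_of_le hx.1.le,
      integral_Ioc_eq_integral_Ioo]
    congr 2
    ext t
    simp only [mem_inter_iff, mem_Ioo, mem_Iio]
    exact ⟨fun h => ⟨h.1.1, h.2⟩, fun h => ⟨⟨h.1, h.2.trans hx.2⟩, h.2⟩⟩
  set p : ℝ → ℂ := fun x => ∫ t in (0 : ℝ)..x, g t with hp
  have hpi : Integrable p (volume.restrict (Ioo (0 : ℝ) 1)) := by
    have : IntegrableOn p (Icc 0 1) := hcont.integrableOn_compact isCompact_Icc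
    exact this.mono_set Ioo_subset_Icc_self
  obtain ⟨c, hc⟩ := ae_eq_const_of_integral_deriv (f := fun x => f x - p x)
    (f.integrable.sub hpi) (by
      intro φ hφ hφc hφs
      have hd : Continuous (deriv φ) := hφ.continuous_deriv (by simp)
      simp_rw [smul_sub]
      rw [integral_sub (integrable_smul_of_contDiff hd hφc.deriv f.integrable)
        (integrable_smul_of_contDiff hd hφc.deriv hpi), h φ hφ hφc hφs,
        ← integral_deriv_smul_primitive g.integrable hφ hφc hφs, sub_eq_zero]
      refine setIntegral_congr_fun measurableSet_Ioo fun x hx => ?_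
      simp only [heq x hx, hp])
  refine ⟨⟨fun x => p x + c, (continuousOn_iff_continuous_domRestrict.1 hcont).add
    continuous_const⟩, ?_⟩
  unfold IsContRep
  filter_upwards [hc, ae_restrict_mem measurableSet_Ioo] with x hx hx'
  rw [IccExtend_of_mem _ _ (Ioo_subset_Icc_self hx')]
  change f x = p x + c
  rw [← hx]; ring

theorem IsContRep.unique {f : L2Unit} {F₁ F₂ : C(Icc (0 : ℝ) 1, ℂ)} (h₁ : IsContRep f F₁)
    (h₂ : IsContRep f F₂) : F₁ = F₂ := by
  have hae : IccExtend zero_le_one F₁ =ᵐ[volume.restrict (Ioo (0 : ℝ) 1)]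
      IccExtend zero_le_one F₂ := by
    unfold IsContRep at h₁ h₂
    filter_upwards [h₁, h₂] with x a b
    rw [← a, b]
  have hae' : IccExtend zero_le_one F₁ =ᵐ[volume.restrict (Icc (0 : ℝ) 1)]
      IccExtend zero_le_one F₂ := by
    rwa [restrict_Ioo_eq_restrict_Icc] at hae
  have := Measure.eqOn_Icc_of_ae_eq volume (zero_ne_one' ℝ) hae'
    F₁.continuous.Icc_extend'.continuousOn F₂.continuous.Icc_extend'.continuousOn
  ext x
  have h := this x.2
  rwa [IccExtend_of_mem _ _ x.2, IccExtend_of_mem _ _ x.2] at h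

theorem IsContRep.add {f₁ f₂ : L2Unit} {F₁ F₂ : C(Icc (0 : ℝ) 1, ℂ)} (h₁ : IsContRep f₁ F₁)
    (h₂ : IsContRep f₂ F₂) : IsContRep (f₁ + f₂) (F₁ + F₂) := by
  unfold IsContRep at *
  filter_upwards [h₁, h₂, Lp.coeFn_add f₁ f₂] with x a b e
  rw [e, Pi.add_apply, a, b]
  rfl

theorem IsContRep.smul {f : L2Unit} {F : C(Icc (0 : ℝ) 1, ℂ)} (c : ℂ) (h : IsContRep f F) :
    IsContRep (c • f) (c • F) := by
  unfold IsContRep at *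
  filter_upwards [h, Lp.coeFn_smul c f] with x a e
  rw [e, Pi.smul_apply, a]
  rfl

theorem exists_isContRep (f : sobolevH1) :
    ∃ F : C(Icc (0 : ℝ) 1, ℂ), IsContRep f F :=
  (isWeakDeriv_weakDeriv f).exists_contRep

/-- The continuous representative of a function in `H¹(0,1)`, an element of `C[0,1]`. -/
def contRep : sobolevH1 →ₗ[ℂ] C(Icc (0 : ℝ) 1, ℂ) where
  toFun f := (exists_isContRep f).choose
  map_add' f g := (exists_isContRep (f + g)).choose_spec.unique
    ((exists_isContRep f).choose_spec.add (exists_isContRep g).choose_spec)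
  map_smul' c f := (exists_isContRep (c • f)).choose_spec.unique ((exists_isContRep f).choose_spec.smul c)

theorem isContRep_contRep (f : sobolevH1) : IsContRep f (contRep f) :=
  (exists_isContRep f).choose_spec

end Sobolev

/-! ### The single heat equation on `(0,1)` -/

section Heat

/-- `L w = β w''` with `D(L) = H²(0,1)`. -/
def heatL (β : ℝ) : L2Unit →ₗ.[ℂ] L2Unit where
  domain := sobolevH2
  toFun := (β : ℂ) • weakDeriv.comp sobolevDeriv

/-- `G w = (w(0), w(1))`. -/
def heatG (β : ℝ) : (heatL β).domain →ₗ[ℂ] EuclideanSpace ℂ (Fin 2) where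
  toFun w := !₂[contRep (sobolevIncl w) 0, contRep (sobolevIncl w) 1]
  map_add' v w := by
    have e : sobolevIncl (v + w) = sobolevIncl v + sobolevIncl w := map_add (sobolevIncl) v w
    ext i; fin_cases i <;> simp [e]
  map_smul' c w := by
    have e : sobolevIncl (c • w) = c • sobolevIncl w := map_smul (sobolevIncl) c w
    ext i; fin_cases i <;> simp [e]

/-- `K w = (-β w'(0), β w'(1))`. -/
def heatK (β : ℝ) : (heatL β).domain →ₗ[ℂ] EuclideanSpace ℂ (Fin 2) where
  toFun w := !₂[-(β : ℂ) * contRep (sobolevDeriv w) 0, (β : ℂ) * contRep (sobolevDeriv w) 1]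
  map_add' v w := by
    have e : sobolevDeriv (v + w) = sobolevDeriv v + sobolevDeriv w := map_add (sobolevDeriv) v w
    ext i; fin_cases i <;> simp [e] <;> ring
  map_smul' c w := by
    have e : sobolevDeriv (c • w) = c • sobolevDeriv w := map_smul (sobolevDeriv) c w
    ext i; fin_cases i <;> simp [e] <;> ring

/-- `p₁(z) = √(zβ) / tanh √(z/β)` for `z ≠ 0` and `p₁(0) = β`; `Complex.sqrt` is the principal
branch of the square root. -/
def heatP1 (β : ℝ) (z : ℂ) : ℂ :=
  if z = 0 then β else Complex.sqrt (z * β) / Complex.tanh (Complex.sqrt (z / β))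

/-- `p₂(z) = -√(zβ) / sinh √(z/β)` for `z ≠ 0` and `p₂(0) = -β`. -/
def heatP2 (β : ℝ) (z : ℂ) : ℂ :=
  if z = 0 then -β else -Complex.sqrt (z * β) / Complex.sinh (Complex.sqrt (z / β))

end Heat

end

/-! Everything about `A`, the restriction of `L` to `Ker G`, is read off from its negative inverse.
Put `S = (-A)⁻¹`, the solution operator of `-β w'' = f` with `w(0) = w(1) = 0`. Integrating twice
and correcting by a multiple of `x` shows that `-A` is onto; the energy identity `Re⟨Lw, w⟩ = Re⟨Gw,
Kw⟩ - β‖w'‖²`, which also gives passivity, shows that it is injective. By Green's identities `S` is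
symmetric and positive, hence bounded by Hellinger–Toeplitz.

For a bounded, positive, injective `S` the semigroup generated by `-S⁻¹` is obtained from the
continuous functional calculus of `S` applied to `s ↦ e^{-t/s}`. Its spectrum lies in `[0, ‖S‖]`,
where this function is at most `e^{-t/‖S‖}`: this is the exponential decay. Strong continuity and
the identification of the generator come from elementary inequalities for `s(e^{-t/s} - 1)` on the
spectrum and the density of the range of `S`. For `Re z ≥ 0` the resolvent is `S(1 + zS)⁻¹`, which
exists because `-1/z` is never in `[0, ∞)`.

Surjectivity of `(G, K)` is cubic Hermite interpolation. It also gives boundedness of `G` and `K`: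
any combination of the four traces of `w` is the boundary term in Green's second identity against a
fixed cubic `v`, so Cauchy–Schwarz bounds it by the graph norm. The transfer function follows from
the explicit solution of `z w = β w''` by hyperbolic sines (by an affine function for `z = 0`). -/

noncomputable section

/-! ### The contraction semigroup generated by `-S⁻¹` for a positive injective operator `S` -/

section NegInverse

/-- The function `s ↦ e^{-t/s}`, extended by `0` to `s = 0`. -/
def expNegDiv (t s : ℝ) : ℝ := if s = 0 then 0 else Real.exp (-(t / s))

theorem expNegDiv_nonneg (t s : ℝ) : 0 ≤ expNegDiv t s := by
  unfold expNegDiv; split_ifs <;> positivity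

theorem expNegDiv_le_exp {t s N : ℝ} (ht : 0 ≤ t) (hs : 0 ≤ s) (hN : s ≤ N) :
    expNegDiv t s ≤ Real.exp (-(t / N)) := by
  unfold expNegDiv
  split_ifs with h
  · positivity
  · have hs' : 0 < s := lt_of_le_of_ne hs (Ne.symm h)
    gcongr

theorem expNegDiv_le_one {t s : ℝ} (ht : 0 ≤ t) (hs : 0 ≤ s) : expNegDiv t s ≤ 1 :=
  (expNegDiv_le_exp ht hs le_rfl).trans (Real.exp_le_one_iff.2 (by simp; positivity))

theorem expNegDiv_mul (t₁ t₂ s : ℝ) :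
    expNegDiv t₁ s * expNegDiv t₂ s = expNegDiv (t₁ + t₂) s := by
  unfold expNegDiv
  split_ifs with h
  · simp
  · rw [← Real.exp_add]; congr 1; ring

/-- This is `e^{t/s} ≥ 1 + t/s`, cleared of denominators so that it survives at `s = 0`. It gives
both the continuity of `expNegDiv t` at `0` and the upper half of the second-order estimate
`norm_negInvExp_sub_one_mul_add_le`. -/
theorem add_mul_expNegDiv_le {t s : ℝ} (hs : 0 ≤ s) :
    (s + t) * expNegDiv t s ≤ s := by
  unfold expNegDiv
  split_ifs with h
  · simpa using hs
  · have hs' : 0 < s := lt_of_le_of_ne hs (Ne.symm h)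
    have h1 := Real.add_one_le_exp (t / s)
    rw [Real.exp_neg, ← div_eq_mul_inv, div_le_iff₀ (Real.exp_pos _)]
    calc s + t = s * (t / s + 1) := by field_simp; ring
      _ ≤ _ := by gcongr

theorem le_mul_expNegDiv {t s : ℝ} (ht : 0 ≤ t) (hs : 0 ≤ s) : s - t ≤ s * expNegDiv t s := by
  unfold expNegDiv
  split_ifs with h
  · simp [h, ht]
  · have hs' : 0 < s := lt_of_le_of_ne hs (Ne.symm h)
    have h1 := Real.one_sub_le_exp_neg (t / s)
    calc s - t = s * (1 - t / s) := by field_simp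
      _ ≤ _ := by gcongr

/-- At `s = 0` the function is squeezed between `0` and `s / t`. Positivity of `t` is essential:
`expNegDiv 0` jumps from `0` to `1`. -/
theorem continuousOn_expNegDiv {t : ℝ} (ht : 0 < t) : ContinuousOn (expNegDiv t) (Ici 0) := by
  intro s hs
  rcases eq_or_lt_of_le (mem_Ici.1 hs) with rfl | hs'
  · have h0 : expNegDiv t 0 = 0 := by simp [expNegDiv]
    unfold ContinuousWithinAt
    rw [h0]
    refine squeeze_zero' (Eventually.of_forall fun s => expNegDiv_nonneg t s)
      (g := fun s => t⁻¹ * s) ?_ ?_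
    · filter_upwards [self_mem_nhdsWithin] with s hs
      have h1 := add_mul_expNegDiv_le (t := t) hs
      have h2 := mul_nonneg (mem_Ici.1 hs) (expNegDiv_nonneg t s)
      rw [← div_eq_inv_mul, le_div_iff₀ ht]
      linarith
    · have : Continuous fun s : ℝ => t⁻¹ * s := by fun_prop
      have h1 := (this.tendsto 0).mono_left (nhdsWithin_le_nhds (s := Ici 0))
      rwa [mul_zero] at h1
  · refine ContinuousAt.continuousWithinAt ?_
    have h1 : ContinuousAt (fun s => Real.exp (-(t / s))) s := by
      have := hs'.ne'
      fun_prop (disch := assumption)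
    refine h1.congr ?_
    filter_upwards [isOpen_ne.mem_nhds hs'.ne'] with r hr
    simp [expNegDiv, hr]

variable {H : Type*} [NormedAddCommGroup H] [InnerProductSpace ℂ H]

/-- A uniformly bounded family of operators converges strongly to `0` if it does so, at a uniform
rate, after composition with an operator of dense range. -/
theorem tendsto_zero_of_dense {ι : Type*} {l : Filter ι} {D : ι → H →L[ℂ] H} {S : H →L[ℂ] H}
    {τ : ι → ℝ} (hS : DenseRange S) (hτ : Tendsto τ l (𝓝 0)) {C : ℝ}
    (hC : ∀ᶠ i in l, ‖D i‖ ≤ C) (hDS : ∀ᶠ i in l, ‖D i * S‖ ≤ τ i) (x : H) :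
    Tendsto (fun i => D i x) l (𝓝 0) := by
  rw [Metric.tendsto_nhds]
  intro ε hε
  have hC' : 0 < |C| + 1 := by positivity
  obtain ⟨z, hz⟩ := hS.exists_dist_lt x (ε := ε / 2 / (|C| + 1)) (by positivity)
  have h1 : Tendsto (fun i => τ i * ‖z‖) l (𝓝 0) := by simpa using hτ.mul_const ‖z‖
  filter_upwards [hC, hDS, h1.eventually (gt_mem_nhds (half_pos hε))] with i a b c
  rw [dist_zero_right]
  have e : D i x = D i (x - S z) + (D i * S) z := by simp
  rw [e]
  have h2 : ‖D i (x - S z)‖ ≤ (|C| + 1) * (ε / 2 / (|C| + 1)) := by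
    refine ((D i).le_opNorm _).trans ?_
    rw [dist_eq_norm] at hz
    gcongr
    linarith [le_abs_self C]
  have h3 : ‖(D i * S) z‖ ≤ τ i * ‖z‖ := ((D i * S).le_opNorm z).trans (by gcongr)
  have h4 : (|C| + 1) * (ε / 2 / (|C| + 1)) = ε / 2 := by field_simp
  linarith [norm_add_le (D i (x - S z)) ((D i * S) z)]

variable [CompleteSpace H]

/-- The orthogonal complement of the range is the kernel of the adjoint, here `Ker S = 0`. -/
theorem denseRange_of_isSelfAdjoint {S : H →L[ℂ] H} (hS : IsSelfAdjoint S)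
    (hinj : Function.Injective S) : DenseRange S := by
  have h : (LinearMap.range S.toLinearMap).topologicalClosure = ⊤ := by
    rw [Submodule.topologicalClosure_eq_top_iff, ContinuousLinearMap.orthogonal_range, hS.adjoint_eq]
    exact LinearMap.ker_eq_bot.2 hinj
  have := (Submodule.dense_iff_topologicalClosure_eq_top).2 h
  simpa [DenseRange, LinearMap.coe_range] using this

/-! ### Functional calculus of `S`, the semigroup and its generator -/

variable {S : H →L[ℂ] H}

theorem spectrum_subset_Ici (hS : 0 ≤ S) : spectrum ℝ S ⊆ Ici 0 :=
  fun _ hs => spectrum_nonneg_of_nonneg hS hs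

/-- The operators `e^{-t S⁻¹}`, `t ≥ 0`. -/
def negInvExp (S : H →L[ℂ] H) (t : ℝ≥0) : H →L[ℂ] H :=
  -- At `t = 0` the function vanishes at `s = 0` and is `1` elsewhere, so the functional calculus
  -- need not return the identity; that value is set by hand.
  if t = 0 then 1 else cfc (expNegDiv t) S

theorem continuousOn_spectrum (hS : 0 ≤ S) {t : ℝ≥0} (ht : t ≠ 0) :
    ContinuousOn (expNegDiv t) (spectrum ℝ S) :=
  (continuousOn_expNegDiv (by positivity)).mono (spectrum_subset_Ici hS)

theorem negInvExp_add (hS : 0 ≤ S) (t₁ t₂ : ℝ≥0) :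
    negInvExp S (t₁ + t₂) = negInvExp S t₁ * negInvExp S t₂ := by
  rcases eq_or_ne t₁ 0 with rfl | h₁
  · simp [negInvExp]
  rcases eq_or_ne t₂ 0 with rfl | h₂
  · simp [negInvExp]
  have h₃ : t₁ + t₂ ≠ 0 := by positivity
  rw [negInvExp, negInvExp, negInvExp, if_neg h₁, if_neg h₂, if_neg h₃,
    ← cfc_mul _ _ S (continuousOn_spectrum hS h₁) (continuousOn_spectrum hS h₂)]
  refine cfc_congr fun s _ => ?_
  simp only [expNegDiv_mul, NNReal.coe_add]

theorem commute_negInvExp (hS : 0 ≤ S) (t : ℝ≥0) : Commute (negInvExp S t) S := by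
  unfold negInvExp
  split_ifs
  · exact Commute.one_left S
  · conv_rhs => rw [← cfc_id ℝ S hS.isSelfAdjoint]
    exact cfc_commute_cfc _ _ _

/-- The spectrum lies in `[0, ‖S‖]` and `s ↦ e^{-t/s}` is increasing there. A free `N ≥ ‖S‖` lets
one bound serve for contractivity and for a decay rate with nonzero denominator. -/
theorem norm_negInvExp_le (hS : 0 ≤ S) {N : ℝ} (hN : ‖S‖ ≤ N) (t : ℝ≥0) :
    ‖negInvExp S t‖ ≤ Real.exp (-((t : ℝ) / N)) := by
  unfold negInvExp
  split_ifs with ht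
  · subst ht
    have h : ‖(1 : H →L[ℂ] H)‖ ≤ 1 := ContinuousLinearMap.norm_id_le
    simpa using h
  · refine norm_cfc_le (by positivity) fun s hs => ?_
    rw [Real.norm_of_nonneg (expNegDiv_nonneg _ _)]
    have h1 : ‖s‖ ≤ ‖S‖ * ‖(1 : H →L[ℂ] H)‖ := spectrum.norm_le_norm_mul_of_mem hs
    have h2 : ‖(1 : H →L[ℂ] H)‖ ≤ 1 := ContinuousLinearMap.norm_id_le
    refine expNegDiv_le_exp t.2 (spectrum_subset_Ici hS hs) ?_
    have h3 := mul_le_mul_of_nonneg_left h2 (norm_nonneg S)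
    linarith [le_abs_self s, Real.norm_eq_abs s]

theorem norm_negInvExp_le_one (hS : 0 ≤ S) (t : ℝ≥0) : ‖negInvExp S t‖ ≤ 1 :=
  (norm_negInvExp_le hS le_rfl t).trans (Real.exp_le_one_iff.2 (by simp; positivity))

/-- On the spectrum, `s - t ≤ s e^{-t/s} ≤ s`. This is the uniform rate on the range of `S` that
yields strong continuity. -/
theorem norm_negInvExp_sub_one_mul_le (hS : 0 ≤ S) (t : ℝ≥0) :
    ‖(negInvExp S t - 1) * S‖ ≤ t := by
  rcases eq_or_ne t 0 with rfl | ht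
  · simp [negInvExp]
  have hc := continuousOn_spectrum hS ht
  have hsa := hS.isSelfAdjoint
  have e : (negInvExp S t - 1) * S = cfc (fun s => (expNegDiv t s - 1) * s) S := by
    rw [cfc_mul (fun s => expNegDiv t s - 1) (fun s => s) S (by fun_prop) (by fun_prop),
      cfc_sub (expNegDiv t) (fun _ => 1) S hc (by fun_prop), cfc_const_one ℝ S, cfc_id' ℝ S,
      negInvExp, if_neg ht]
  rw [e]
  refine norm_cfc_le t.2 fun s hs => ?_
  have hs' : 0 ≤ s := spectrum_subset_Ici hS hs
  have ht0 : (0 : ℝ) ≤ t := t.2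
  have h1 := le_mul_expNegDiv ht0 hs'
  have h2 := mul_le_mul_of_nonneg_left (expNegDiv_le_one ht0 hs') hs'
  rw [Real.norm_eq_abs, abs_le]
  constructor <;> linarith

/-- The second-order Taylor remainder: `s(e^{-t/s} - 1) + t` behaves like `t²/(2s)` for small `t`,
and the extra factor `S` makes it `O(t²)` uniformly in `s`. After division by `t` it controls the
difference quotients on the range of `S`. -/
theorem norm_negInvExp_sub_one_mul_add_le (hS : 0 ≤ S) (t : ℝ≥0) :
    ‖((negInvExp S t - 1) * S + ((t : ℝ) : ℂ) • 1) * S‖ ≤ t * t := by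
  rcases eq_or_ne t 0 with rfl | ht
  · simp [negInvExp]
  have hc := continuousOn_spectrum hS ht
  have hsa := hS.isSelfAdjoint
  have e : ((negInvExp S t - 1) * S + ((t : ℝ) : ℂ) • 1) * S =
      cfc (fun s => ((expNegDiv t s - 1) * s + (t : ℝ)) * s) S := by
    rw [cfc_mul (fun s => (expNegDiv t s - 1) * s + (t : ℝ)) (fun s => s) S (by fun_prop)
        (by fun_prop),
      cfc_add (a := S) (fun s => (expNegDiv t s - 1) * s) (fun _ => (t : ℝ)) (by fun_prop)
        (by fun_prop),
      cfc_mul (fun s => expNegDiv t s - 1) (fun s => s) S (by fun_prop) (by fun_prop),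
      cfc_sub (expNegDiv t) (fun _ => 1) S hc (by fun_prop), cfc_const_one ℝ S, cfc_id' ℝ S,
      cfc_const (t : ℝ) S, negInvExp, if_neg ht, Algebra.algebraMap_eq_smul_one]
    rfl
  rw [e]
  refine norm_cfc_le (by positivity) fun s hs => ?_
  have hs' : 0 ≤ s := spectrum_subset_Ici hS hs
  have ht0 : (0 : ℝ) ≤ t := t.2
  have h1 := le_mul_expNegDiv ht0 hs'
  have h2 := add_mul_expNegDiv_le (t := t) hs'
  have h3 : (s - t) * s ≤ s * expNegDiv t s * s := mul_le_mul_of_nonneg_right h1 hs'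
  rw [Real.norm_eq_abs, abs_le]
  have h4 : s * ((s + t) * expNegDiv t s) ≤ s * s := mul_le_mul_of_nonneg_left h2 hs'
  have h5 : t * (s - t) ≤ t * (s * expNegDiv t s) := mul_le_mul_of_nonneg_left h1 ht0
  -- With `e = expNegDiv t s`: `h3` gives the stronger lower bound `0`, and adding `h4` to `h5`
  -- gives `s²e + ts - s² ≤ t²`.
  constructor <;> nlinarith

/-- The `C₀`-semigroup `t ↦ e^{-t S⁻¹}`. -/
def negInvSemigroup (S : H →L[ℂ] H) (hS : 0 ≤ S) (hinj : Function.Injective S) :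
    C0Semigroup H where
  toFun := negInvExp S
  map_zero := by simp [negInvExp]; rfl
  map_add := negInvExp_add hS
  tendsto_zero x := by
    have h := tendsto_zero_of_dense (l := 𝓝 (0 : ℝ≥0)) (D := fun t => negInvExp S t - 1)
      (τ := fun t => (t : ℝ)) (C := 2) (denseRange_of_isSelfAdjoint hS.isSelfAdjoint hinj)
      (by simpa using (NNReal.continuous_coe.tendsto 0))
      (Eventually.of_forall fun t => ?_)
      (Eventually.of_forall fun t => norm_negInvExp_sub_one_mul_le hS t) x
    · simpa using h.add_const x
    · have h2 : ‖(1 : H →L[ℂ] H)‖ ≤ 1 := ContinuousLinearMap.norm_id_le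
      linarith [norm_sub_le (negInvExp S t) 1, norm_negInvExp_le_one hS t]

theorem isUniformlyExponentiallyStable_negInvSemigroup (hS : 0 ≤ S)
    (hinj : Function.Injective S) :
    (negInvSemigroup S hS hinj).IsUniformlyExponentiallyStable := by
  -- The summand `1` keeps the rate positive without showing `‖S‖ ≠ 0`.
  refine ⟨1, (‖S‖ + 1)⁻¹, by positivity, fun t => ?_⟩
  rw [one_mul]
  refine (norm_negInvExp_le hS (N := ‖S‖ + 1) (by linarith) t).trans_eq ?_
  congr 1
  rw [div_eq_inv_mul, neg_mul]

/-- The operators `t⁻¹((T(t) - 1)S + t)` have norm at most `2` and, composed with `S`, norm at most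
`t`; hence they tend strongly to `0`. -/
theorem tendsto_negInvExp_quotient (hS : 0 ≤ S) (hinj : Function.Injective S) (x : H) :
    Tendsto (fun t : ℝ≥0 => (((t : ℝ) : ℂ)⁻¹) • ((negInvExp S t - 1) * S) x) (𝓝[>] 0)
      (𝓝 (-x)) := by
  have hpos : ∀ᶠ t : ℝ≥0 in 𝓝[>] 0, 0 < t := self_mem_nhdsWithin
  have h2 : ‖(1 : H →L[ℂ] H)‖ ≤ 1 := ContinuousLinearMap.norm_id_le
  have hn : ∀ t : ℝ≥0, ‖((t : ℝ) : ℂ)⁻¹‖ = (t : ℝ)⁻¹ := fun t => by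
    rw [norm_inv, Complex.norm_of_nonneg t.coe_nonneg]
  have h := tendsto_zero_of_dense (l := 𝓝[>] (0 : ℝ≥0))
    (D := fun t => (((t : ℝ) : ℂ)⁻¹) • ((negInvExp S t - 1) * S + ((t : ℝ) : ℂ) • 1))
    (τ := fun t => (t : ℝ)) (C := 2) (denseRange_of_isSelfAdjoint hS.isSelfAdjoint hinj)
    ((by simpa using (NNReal.continuous_coe.tendsto 0) :
      Tendsto (fun t : ℝ≥0 => (t : ℝ)) (𝓝 0) (𝓝 0)).mono_left nhdsWithin_le_nhds) ?_ ?_ x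
  · have h' := h.add_const (-x)
    rw [zero_add] at h'
    refine h'.congr' ?_
    filter_upwards [hpos] with t ht
    have ht' : ((t : ℝ) : ℂ) ≠ 0 := by exact_mod_cast ht.ne'
    simp only [smul_add, smul_smul, inv_mul_cancel₀ ht', one_smul]
    simp
  · filter_upwards [hpos] with t ht
    have ht' : (0 : ℝ) < t := ht
    rw [norm_smul, hn, inv_mul_le_iff₀ ht']
    have h3 := norm_add_le ((negInvExp S t - 1) * S) (((t : ℝ) : ℂ) • (1 : H →L[ℂ] H))
    rw [norm_smul, Complex.norm_of_nonneg t.coe_nonneg] at h3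
    nlinarith [norm_negInvExp_sub_one_mul_le hS t]
  · filter_upwards [hpos] with t ht
    have ht' : (0 : ℝ) < t := ht
    rw [smul_mul_assoc, norm_smul, hn, inv_mul_le_iff₀ ht']
    exact norm_negInvExp_sub_one_mul_add_le hS t

/-- The hypothesis `hA` says that `A = -S⁻¹` as graphs, which avoids handling an unbounded inverse.
-/
theorem isGeneratedBy_negInvSemigroup (hS : 0 ≤ S) (hinj : Function.Injective S)
    {A : H →ₗ.[ℂ] H} (hA : ∀ x y, (∃ h : x ∈ A.domain, A ⟨x, h⟩ = y) ↔ x = -S y) :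
    (negInvSemigroup S hS hinj).IsGeneratedBy A := by
  intro x y
  rw [hA]
  change _ ↔ Tendsto (fun t : ℝ≥0 => (((t : ℝ) : ℂ)⁻¹) • (negInvExp S t x - x)) _ _
  constructor
  · rintro rfl
    have h := (tendsto_negInvExp_quotient hS hinj y).neg
    rw [neg_neg] at h
    refine h.congr fun t => ?_
    have h1 : ((negInvExp S t - 1) * S) y = negInvExp S t (S y) - S y := rfl
    rw [h1, ← smul_neg, map_neg, neg_sub, neg_sub_neg]
  · intro h
    have h1 := (S.continuous.tendsto y).comp h
    have h2 := tendsto_negInvExp_quotient hS hinj x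
    -- Applying `S` to the difference quotients of `x` gives the limit `S y`; since `S` commutes
    -- with the semigroup these are also the quotients of `S x`, whose limit is `-x`.
    have h3 : S y = -x := by
      refine tendsto_nhds_unique h1 (h2.congr fun t => ?_)
      have h4 : negInvExp S t (S x) = S (negInvExp S t x) :=
        DFunLike.congr_fun (commute_negInvExp hS t).eq x
      simp [h4]
    rw [h3, neg_neg]

open scoped ComplexOrder in
/-- The closed right half-plane lies in the resolvent set of `-S⁻¹`. -/
theorem mem_operatorResolventSet_of_negInv (hS : 0 ≤ S)
    {A : H →ₗ.[ℂ] H} (hA : ∀ x y, (∃ h : x ∈ A.domain, A ⟨x, h⟩ = y) ↔ x = -S y)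
    {z : ℂ} (hz : 0 ≤ z.re) : z ∈ operatorResolventSet A := by
  -- Formally `z + S⁻¹ = (1 + zS)S⁻¹`, so only `1 + zS = -z(-z⁻¹ - S)` has to be inverted. A
  -- spectral value `-z⁻¹` would be real and nonnegative, while `Re z ≥ 0` makes its real part
  -- nonpositive; it would then vanish.
  have hu : IsUnit (1 + z • S) := by
    rcases eq_or_ne z 0 with rfl | hz0
    · simp
    have h1 : -z⁻¹ ∉ spectrum ℂ S := by
      intro hmem
      obtain ⟨h2, h3⟩ := Complex.nonneg_iff.1 (spectrum_nonneg_of_nonneg hS hmem)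
      have h4 : 0 < Complex.normSq z := Complex.normSq_pos.2 hz0
      simp only [Complex.neg_re, Complex.neg_im, Complex.inv_re, Complex.inv_im] at h2 h3
      have h5 : z.re = 0 := by
        have := div_nonneg hz h4.le
        have h6 : z.re / Complex.normSq z = 0 := by linarith
        simpa [h4.ne'] using h6
      have h7 : z.im = 0 := by
        have h8 : z.im / Complex.normSq z = 0 := by
          rw [neg_div, neg_neg] at h3; exact h3.symm
        simpa [h4.ne'] using h8
      exact hz0 (Complex.ext h5 h7)
    rw [spectrum.notMem_iff] at h1
    have h2 : 1 + z • S = (-z) • (algebraMap ℂ (H →L[ℂ] H) (-z⁻¹) - S) := by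
      rw [Algebra.algebraMap_eq_smul_one, smul_sub, smul_smul]
      simp [hz0]
    rw [h2]
    exact (isUnit_smul_iff (Units.mk0 (-z) (neg_ne_zero.2 hz0)) _).2 h1
  obtain ⟨V, hV⟩ := hu
  set W : H →L[ℂ] H := ((V⁻¹ : (H →L[ℂ] H)ˣ) : H →L[ℂ] H) with hW
  have hVW : (1 + z • S) * W = 1 := by rw [← hV]; exact V.mul_inv
  have hWV : W * (1 + z • S) = 1 := by rw [← hV]; exact V.inv_mul
  have hc : Commute W S := by
    have : Commute (V : H →L[ℂ] H) S := by
      rw [hV]; exact (Commute.one_left S).add_left ((Commute.refl S).smul_left z)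
    exact this.units_inv_left
  refine ⟨S * W, fun y => ?_, fun x => ?_⟩
  · obtain ⟨h, hAx⟩ := (hA (S (W y)) (-W y)).2 (by simp)
    refine ⟨⟨_, h⟩, rfl, ?_⟩
    rw [hAx]
    have := DFunLike.congr_fun hVW y
    rw [sub_neg_eq_add, add_comm]
    exact this
  · have hx := (hA x (A x)).1 ⟨x.2, rfl⟩
    have h1 : S (z • (x : H) - A x) = (1 + z • S) (x : H) := by
      have : -S (A x) = x := hx.symm
      rw [map_sub, map_smul, sub_eq_add_neg, this, add_comm]
      rfl
    have h2 : (S * W) (z • (x : H) - A x) = W (S (z • (x : H) - A x)) :=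
      (DFunLike.congr_fun hc.eq _).symm
    rw [h2, h1]
    exact DFunLike.congr_fun hWV (x : H)

end NegInverse

/-! ### The fundamental theorem of calculus and integration by parts in `H¹(0,1)` -/

section SobolevCalculus

theorem integral_indicator_Iio_eq {E : Type*} [NormedAddCommGroup E] [NormedSpace ℝ E]
    (g : ℝ → E) {x : ℝ} (hx : x ∈ Icc (0 : ℝ) 1) :
    ∫ t in Ioo (0 : ℝ) 1, (Iio x).indicator g t = ∫ t in (0 : ℝ)..x, g t := by
  rw [setIntegral_indicator measurableSet_Iio, intervalIntegral.integral_of_le hx.1,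
    integral_Ioc_eq_integral_Ioo]
  congr 2
  ext t
  simp only [mem_inter_iff, mem_Ioo, mem_Iio]
  exact ⟨fun h => ⟨h.1.1, h.2⟩, fun h => ⟨⟨h.1, h.2.trans_le hx.2⟩, h.2⟩⟩

theorem integral_indicator_Ioi_eq {E : Type*} [NormedAddCommGroup E] [NormedSpace ℝ E]
    (g : ℝ → E) {x : ℝ} (hx : x ∈ Icc (0 : ℝ) 1) :
    ∫ t in Ioo (0 : ℝ) 1, (Ioi x).indicator g t = ∫ t in x..1, g t := by
  rw [setIntegral_indicator measurableSet_Ioi, intervalIntegral.integral_of_le hx.2,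
    integral_Ioc_eq_integral_Ioo]
  congr 2
  ext t
  simp only [mem_inter_iff, mem_Ioo, mem_Ioi]
  exact ⟨fun h => ⟨h.2, h.1.2⟩, fun h => ⟨⟨hx.1.trans_lt h.1, h.2⟩, h.1⟩⟩

theorem integral_Ioo_eq_intervalIntegral {E : Type*} [NormedAddCommGroup E] [NormedSpace ℝ E]
    (g : ℝ → E) : ∫ t in Ioo (0 : ℝ) 1, g t = ∫ t in (0 : ℝ)..1, g t := by
  rw [intervalIntegral.integral_of_le zero_le_one, integral_Ioc_eq_integral_Ioo]

theorem intervalIntegrable_of_Ioo {g : ℝ → ℂ}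
    (hg : Integrable g (volume.restrict (Ioo (0 : ℝ) 1))) {a b : ℝ} (ha : a ∈ Icc (0 : ℝ) 1)
    (hb : b ∈ Icc (0 : ℝ) 1) : IntervalIntegrable g volume a b := by
  refine IntegrableOn.intervalIntegrable ?_
  have h : IntegrableOn g (Icc 0 1) := by rwa [integrableOn_Icc_iff_integrableOn_Ioo]
  exact h.mono_set (uIcc_subset_Icc ha hb)

theorem continuousOn_primitive_Icc {g : ℝ → ℂ}
    (hg : Integrable g (volume.restrict (Ioo (0 : ℝ) 1))) :
    ContinuousOn (fun x => ∫ t in (0 : ℝ)..x, g t) (Icc 0 1) := by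
  have := intervalIntegral.continuousOn_primitive_interval (μ := volume) (f := g) (a := 0)
    (b := 1) (by rwa [uIcc_of_le zero_le_one, integrableOn_Icc_iff_integrableOn_Ioo])
  rwa [uIcc_of_le zero_le_one] at this

theorem integrable_mul_primitive {a b : ℝ → ℂ}
    (ha : Integrable a (volume.restrict (Ioo (0 : ℝ) 1)))
    (hb : Integrable b (volume.restrict (Ioo (0 : ℝ) 1))) :
    Integrable (fun x => a x * ∫ t in (0 : ℝ)..x, b t) (volume.restrict (Ioo (0 : ℝ) 1)) := by
  have hc := continuousOn_primitive_Icc hb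
  obtain ⟨C, hC⟩ := isCompact_Icc.exists_bound_of_continuousOn hc
  refine ha.mul_bdd (c := C) ((hc.mono Ioo_subset_Icc_self).aestronglyMeasurable measurableSet_Ioo) ?_
  filter_upwards [ae_restrict_mem measurableSet_Ioo] with x hx
  exact hC x (Ioo_subset_Icc_self hx)

/-- Integration by parts for the primitives of two integrable functions on `(0,1)`. -/
theorem integral_mul_primitive_add {a b : ℝ → ℂ}
    (ha : Integrable a (volume.restrict (Ioo (0 : ℝ) 1)))
    (hb : Integrable b (volume.restrict (Ioo (0 : ℝ) 1))) :
    (∫ x in Ioo (0 : ℝ) 1, a x * ∫ t in (0 : ℝ)..x, b t) +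
      (∫ x in Ioo (0 : ℝ) 1, b x * ∫ t in (0 : ℝ)..x, a t) =
      (∫ x in Ioo (0 : ℝ) 1, a x) * ∫ x in Ioo (0 : ℝ) 1, b x := by
  have hint : Integrable (fun p : ℝ × ℝ => b p.1 * (Iio p.1).indicator a p.2)
      ((volume.restrict (Ioo (0 : ℝ) 1)).prod (volume.restrict (Ioo (0 : ℝ) 1))) := by
    have h1 := (hb.mul_prod ha).indicator (s := {p : ℝ × ℝ | p.2 < p.1})
      (measurableSet_lt measurable_snd measurable_fst)
    refine h1.congr (Eventually.of_forall fun p => ?_)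
    by_cases h : p.2 < p.1 <;> simp [indicator, h]
  -- Fubini on the triangle `t < x`: the inner integral becomes one over `(x, 1)`, complementary to
  -- that of the first summand.
  have h2 : (∫ x in Ioo (0 : ℝ) 1, b x * ∫ t in (0 : ℝ)..x, a t) =
      ∫ x in Ioo (0 : ℝ) 1, a x * ∫ t in x..1, b t := by
    calc (∫ x in Ioo (0 : ℝ) 1, b x * ∫ t in (0 : ℝ)..x, a t)
        = ∫ x in Ioo (0 : ℝ) 1, ∫ t in Ioo (0 : ℝ) 1, b x * (Iio x).indicator a t := by
          refine setIntegral_congr_fun measurableSet_Ioo fun x hx => ?_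
          simp only [integral_const_mul]
          rw [integral_indicator_Iio_eq a (Ioo_subset_Icc_self hx)]
      _ = ∫ t in Ioo (0 : ℝ) 1, ∫ x in Ioo (0 : ℝ) 1, b x * (Iio x).indicator a t :=
          integral_integral_swap hint
      _ = _ := by
          refine setIntegral_congr_fun measurableSet_Ioo fun t ht => ?_
          rw [← integral_indicator_Ioi_eq b (Ioo_subset_Icc_self ht), ← integral_const_mul]
          congr 1
          ext x
          by_cases h : t < x <;> simp [indicator, h, mul_comm]
  have hi2 : Integrable (fun x => a x * ∫ t in x..1, b t) (volume.restrict (Ioo (0 : ℝ) 1)) := by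
    refine ((ha.mul_const (∫ t in (0 : ℝ)..1, b t)).sub (integrable_mul_primitive ha hb)).congr ?_
    filter_upwards [ae_restrict_mem measurableSet_Ioo] with x hx
    have hx' := Ioo_subset_Icc_self hx
    rw [← intervalIntegral.integral_add_adjacent_intervals
      (intervalIntegrable_of_Ioo hb (left_mem_Icc.2 zero_le_one) hx')
      (intervalIntegrable_of_Ioo hb hx' (right_mem_Icc.2 zero_le_one))]
    simp only [Pi.sub_apply]
    ring
  rw [h2, ← integral_add (integrable_mul_primitive ha hb) hi2, ← integral_mul_const]
  refine setIntegral_congr_fun measurableSet_Ioo fun x hx => ?_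
  have hx' := Ioo_subset_Icc_self hx
  rw [← mul_add, intervalIntegral.integral_add_adjacent_intervals
      (intervalIntegrable_of_Ioo hb (left_mem_Icc.2 zero_le_one) hx')
      (intervalIntegrable_of_Ioo hb hx' (right_mem_Icc.2 zero_le_one)),
      integral_Ioo_eq_intervalIntegral]

/-- The class in `L²(0,1)` of a continuous function on `[0,1]`. -/
def L2Unit.ofCont (F : C(Icc (0 : ℝ) 1, ℂ)) : L2Unit :=
  (MemLp.of_bound (μ := volume.restrict (Ioo (0 : ℝ) 1)) (p := 2)
    (f := IccExtend zero_le_one F)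
    F.continuous.Icc_extend'.aestronglyMeasurable ‖F‖
    (Eventually.of_forall fun _ => F.norm_coe_le_norm _)).toLp _

theorem isContRep_ofCont (F : C(Icc (0 : ℝ) 1, ℂ)) : IsContRep (L2Unit.ofCont F) F :=
  MemLp.coeFn_toLp _

theorem IsContRep.eq {f g : L2Unit} {F : C(Icc (0 : ℝ) 1, ℂ)} (hf : IsContRep f F)
    (hg : IsContRep g F) : f = g := by
  refine Lp.ext ?_
  unfold IsContRep at hf hg
  filter_upwards [hf, hg] with x a b
  rw [a, b]

theorem contRep_eq_of_isContRep {f : sobolevH1} {F : C(Icc (0 : ℝ) 1, ℂ)} (h : IsContRep f F) :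
    contRep f = F :=
  (isContRep_contRep f).unique h

theorem weakDeriv_eq_of_isWeakDeriv {f : sobolevH1} {g : L2Unit} (h : IsWeakDeriv f g) :
    weakDeriv f = g :=
  (isWeakDeriv_weakDeriv f).unique h

/-- Every `g ∈ L²(0,1)` has an antiderivative in `H¹(0,1)` with prescribed value at `0`. -/
theorem exists_sobolevH1_primitive (c : ℂ) (g : L2Unit) :
    ∃ f : sobolevH1, weakDeriv f = g ∧
      ∀ x : Icc (0 : ℝ) 1, contRep f x = c + ∫ t in (0 : ℝ)..x, g t := by
  have hcont := continuousOn_primitive_Icc g.integrable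
  let F : C(Icc (0 : ℝ) 1, ℂ) := ⟨fun x => c + ∫ t in (0 : ℝ)..x, g t,
    continuous_const.add (continuousOn_iff_continuous_domRestrict.1 hcont)⟩
  have hF := isContRep_ofCont F
  have hpi : Integrable (fun x => ∫ t in (0 : ℝ)..x, g t) (volume.restrict (Ioo (0 : ℝ) 1)) :=
    (hcont.integrableOn_compact isCompact_Icc).mono_set Ioo_subset_Icc_self
  have hw : IsWeakDeriv (L2Unit.ofCont F) g := by
    intro φ hφ hc hs
    have hd : Continuous (deriv φ) := hφ.continuous_deriv (by simp)
    have e : (fun x => deriv φ x • L2Unit.ofCont F x) =ᵐ[volume.restrict (Ioo (0 : ℝ) 1)]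
        fun x => deriv φ x • c + deriv φ x • ∫ t in (0 : ℝ)..x, g t := by
      unfold IsContRep at hF
      filter_upwards [hF, ae_restrict_mem measurableSet_Ioo] with x hx hx'
      rw [hx, IccExtend_of_mem _ _ (Ioo_subset_Icc_self hx'), ← smul_add]
      rfl
    -- The integration constant is invisible because test functions vanish at both endpoints.
    have h0 : ∫ x in Ioo (0 : ℝ) 1, deriv φ x • c = 0 := by
      have h4 : ∫ x in (0 : ℝ)..1, deriv φ x = φ 1 - φ 0 :=
        intervalIntegral.integral_deriv_eq_sub (fun x _ => (hφ.differentiable (by simp)) x)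
          (hd.intervalIntegrable _ _)
      have h5 : φ 1 = 0 := image_eq_zero_of_notMem_tsupport fun h => by simpa using hs h
      have h6 : φ 0 = 0 := image_eq_zero_of_notMem_tsupport fun h => by simpa using hs h
      rw [integral_smul_const, integral_Ioo_eq_intervalIntegral, h4, h5, h6]
      simp
    rw [integral_congr_ae e, integral_add
      (integrable_smul_of_contDiff hd hc.deriv (integrable_const c))
      (integrable_smul_of_contDiff hd hc.deriv hpi), h0, zero_add,
      ← integral_deriv_smul_primitive g.integrable hφ hc hs]
    refine setIntegral_congr_fun measurableSet_Ioo fun x hx => ?_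
    simp only [integral_indicator_Iio_eq _ (Ioo_subset_Icc_self hx)]
  refine ⟨⟨L2Unit.ofCont F, g, hw⟩, weakDeriv_eq_of_isWeakDeriv hw, fun x => ?_⟩
  rw [contRep_eq_of_isContRep (f := ⟨L2Unit.ofCont F, g, hw⟩) hF]
  rfl

/-- Subtracting from `f` a primitive of its weak derivative leaves a function with zero weak
derivative, hence a constant. -/
theorem contRep_eq_add_integral (f : sobolevH1) (x : Icc (0 : ℝ) 1) :
    contRep f x = contRep f 0 + ∫ t in (0 : ℝ)..x, weakDeriv f t := by
  obtain ⟨f₀, h₀, hF₀⟩ := exists_sobolevH1_primitive 0 (weakDeriv f)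
  have hd : IsWeakDeriv (f - f₀ : sobolevH1) 0 := by
    have := isWeakDeriv_weakDeriv (f - f₀)
    rwa [map_sub, h₀, sub_self] at this
  obtain ⟨c, hc⟩ := ae_eq_const_of_integral_deriv (f - f₀ : sobolevH1).1.integrable (by
    intro φ hφ hφc hφs
    rw [hd φ hφ hφc hφs, neg_eq_zero]
    refine (integral_congr_ae (g := fun _ => (0 : ℂ)) ?_).trans (by simp)
    filter_upwards [Lp.coeFn_zero ℂ 2 (volume.restrict (Ioo (0 : ℝ) 1))] with x hx
    rw [hx]; simp)
  have hrep : contRep (f - f₀) = ContinuousMap.const _ c := by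
    refine contRep_eq_of_isContRep ?_
    unfold IsContRep
    filter_upwards [hc] with x hx
    rw [hx]; rfl
  have h1 : ∀ y, contRep f y = contRep f₀ y + c := fun y => by
    have := DFunLike.congr_fun hrep y
    rw [map_sub] at this
    change contRep f y - contRep f₀ y = c at this
    rw [← this]; ring
  rw [h1, h1, hF₀, hF₀]
  simp
  ring

theorem sobolevH1_coe_ae_eq (f : sobolevH1) :
    ∀ᵐ x ∂volume.restrict (Ioo (0 : ℝ) 1),
      (f : L2Unit) x = contRep f 0 + ∫ t in (0 : ℝ)..x, weakDeriv f t := by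
  have h := isContRep_contRep f
  unfold IsContRep at h
  filter_upwards [h, ae_restrict_mem measurableSet_Ioo] with x hx hx'
  rw [hx, IccExtend_of_mem _ _ (Ioo_subset_Icc_self hx'), contRep_eq_add_integral]

theorem contRep_injective {f g : sobolevH1} (h : contRep f = contRep g) : f = g :=
  Subtype.ext ((isContRep_contRep f).eq (h ▸ isContRep_contRep g))

/-- Integration by parts in `H¹(0,1)`. -/
theorem inner_weakDeriv_add (f g : sobolevH1) :
    inner ℂ (weakDeriv f) (g : L2Unit) + inner ℂ (f : L2Unit) (weakDeriv g) =
      starRingEnd ℂ (contRep f 1) * contRep g 1 - starRingEnd ℂ (contRep f 0) * contRep g 0 := by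
  set a : ℝ → ℂ := fun x => starRingEnd ℂ (weakDeriv f x) with ha_def
  set b : ℝ → ℂ := fun x => weakDeriv g x with hb_def
  have hb : Integrable b (volume.restrict (Ioo (0 : ℝ) 1)) := (weakDeriv g).integrable
  have ha : Integrable a (volume.restrict (Ioo (0 : ℝ) 1)) := by
    have := Complex.conjCLE.toContinuousLinearMap.integrable_comp (weakDeriv f).integrable
    exact this
  have hconj : ∀ x : ℝ, 0 ≤ x →
      starRingEnd ℂ (∫ t in (0 : ℝ)..x, weakDeriv f t) = ∫ t in (0 : ℝ)..x, a t := fun x hx => by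
    rw [intervalIntegral.integral_of_le hx, intervalIntegral.integral_of_le hx, ← integral_conj]
  set c := contRep f 0
  set d := contRep g 0
  have e1 : contRep g 1 = d + ∫ x in Ioo (0 : ℝ) 1, b x := by
    rw [contRep_eq_add_integral g 1, integral_Ioo_eq_intervalIntegral]; rfl
  have e2 : starRingEnd ℂ (contRep f 1) = starRingEnd ℂ c + ∫ x in Ioo (0 : ℝ) 1, a x := by
    rw [contRep_eq_add_integral f 1, integral_Ioo_eq_intervalIntegral, map_add]
    congr 1
    exact hconj 1 zero_le_one
  have e3 : inner ℂ (weakDeriv f) (g : L2Unit) =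
      d * (∫ x in Ioo (0 : ℝ) 1, a x) + ∫ x in Ioo (0 : ℝ) 1, a x * ∫ t in (0 : ℝ)..x, b t := by
    rw [L2.inner_def, ← integral_const_mul,
      ← integral_add (ha.const_mul _) (integrable_mul_primitive ha hb)]
    refine integral_congr_ae ?_
    filter_upwards [sobolevH1_coe_ae_eq g] with x hx
    rw [hx, RCLike.inner_apply]
    simp only [ha_def]; ring
  have e4 : inner ℂ (f : L2Unit) (weakDeriv g) =
      starRingEnd ℂ c * (∫ x in Ioo (0 : ℝ) 1, b x) +
        ∫ x in Ioo (0 : ℝ) 1, b x * ∫ t in (0 : ℝ)..x, a t := by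
    rw [L2.inner_def, ← integral_const_mul,
      ← integral_add (hb.const_mul _) (integrable_mul_primitive hb ha)]
    refine integral_congr_ae ?_
    filter_upwards [sobolevH1_coe_ae_eq f, ae_restrict_mem measurableSet_Ioo] with x hx hx'
    rw [hx, RCLike.inner_apply, map_add, hconj x hx'.1.le]
    ring
  rw [e1, e2, e3, e4]
  linear_combination integral_mul_primitive_add ha hb

end SobolevCalculus

/-! ### Traces and Green's identities in `H²(0,1)` -/

section SobolevTraces

theorem sobolevH1_ext {f g : sobolevH1} (h0 : contRep f 0 = contRep g 0)
    (h : weakDeriv f = weakDeriv g) : f = g := by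
  refine contRep_injective (ContinuousMap.ext fun x => ?_)
  rw [contRep_eq_add_integral f, contRep_eq_add_integral g, h0, h]

theorem weakDeriv_sobolevIncl (w : sobolevH2) :
    weakDeriv (sobolevIncl w) = (sobolevDeriv w : L2Unit) := rfl

theorem sobolevIncl_injective : Function.Injective sobolevIncl :=
  Submodule.inclusion_injective _

theorem exists_sobolevH2_primitive (a b : ℂ) (h : L2Unit) :
    ∃ w : sobolevH2, contRep (sobolevIncl w) 0 = a ∧ contRep (sobolevDeriv w) 0 = b ∧
      weakDeriv (sobolevDeriv w) = h := by
  obtain ⟨v, hv, hv0⟩ := exists_sobolevH1_primitive b h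
  obtain ⟨f, hf, hf0⟩ := exists_sobolevH1_primitive a v
  have h1 : IsWeakDeriv f v := hf ▸ isWeakDeriv_weakDeriv f
  have h2 : IsWeakDeriv v h := hv ▸ isWeakDeriv_weakDeriv v
  let w : sobolevH2 := ⟨f, v, h, h1, h2⟩
  have e1 : sobolevIncl w = f := rfl
  have e2 : sobolevDeriv w = v := Subtype.ext (by rw [← weakDeriv_sobolevIncl, e1, hf])
  refine ⟨w, ?_, ?_, ?_⟩
  · rw [e1, hf0]; simp
  · rw [e2, hv0]; simp
  · rw [e2, hv]

/-- A twice continuously differentiable function belongs to `H²(0,1)`. -/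
theorem exists_sobolevH2_of_hasDerivAt {w w' w'' : ℝ → ℂ} (h1 : ∀ x, HasDerivAt w (w' x) x)
    (h2 : ∀ x, HasDerivAt w' (w'' x) x) (hc : Continuous w'') :
    ∃ W : sobolevH2, (∀ x : Icc (0 : ℝ) 1, contRep (sobolevIncl W) x = w x) ∧
      (∀ x : Icc (0 : ℝ) 1, contRep (sobolevDeriv W) x = w' x) ∧
      (∀ᵐ x ∂volume.restrict (Ioo (0 : ℝ) 1), (W : L2Unit) x = w x) ∧
      ∀ᵐ x ∂volume.restrict (Ioo (0 : ℝ) 1), weakDeriv (sobolevDeriv W) x = w'' x := by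
  have key : ∀ {u u' : ℝ → ℂ} {g : L2Unit} {x : ℝ}, x ∈ Icc (0 : ℝ) 1 →
      (∀ x, HasDerivAt u (u' x) x) → Continuous u' →
      (∀ᵐ x ∂volume.restrict (Ioo (0 : ℝ) 1), g x = u' x) →
      u 0 + ∫ t in (0 : ℝ)..x, g t = u x := by
    intro u u' g x hx hu hu' hg
    have e : ∫ t in (0 : ℝ)..x, g t = ∫ t in (0 : ℝ)..x, u' t := by
      rw [← integral_indicator_Iio_eq _ hx, ← integral_indicator_Iio_eq _ hx]
      refine integral_congr_ae ?_
      filter_upwards [hg] with t ht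
      by_cases h : t < x <;> simp [indicator, h, ht]
    rw [e, intervalIntegral.integral_eq_sub_of_hasDerivAt (fun t _ => hu t)
      (hu'.intervalIntegrable _ _)]
    ring
  have hae : ∀ {f : L2Unit} {F : C(Icc (0 : ℝ) 1, ℂ)} {u : ℝ → ℂ}, IsContRep f F →
      (∀ x : Icc (0 : ℝ) 1, F x = u x) →
      ∀ᵐ x ∂volume.restrict (Ioo (0 : ℝ) 1), f x = u x := by
    intro f F u hf hF
    unfold IsContRep at hf
    filter_upwards [hf, ae_restrict_mem measurableSet_Ioo] with x hx hx'
    rw [hx, IccExtend_of_mem _ _ (Ioo_subset_Icc_self hx'), hF]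
  have hc' : Continuous w' := continuous_iff_continuousAt.2 fun x => (h2 x).continuousAt
  let F : C(Icc (0 : ℝ) 1, ℂ) := ⟨fun x => w'' x, hc.comp continuous_subtype_val⟩
  obtain ⟨W, hW0, hW1, hW2⟩ := exists_sobolevH2_primitive (w 0) (w' 0) (L2Unit.ofCont F)
  have a2 : ∀ᵐ x ∂volume.restrict (Ioo (0 : ℝ) 1), weakDeriv (sobolevDeriv W) x = w'' x := by
    rw [hW2]
    exact hae (isContRep_ofCont F) fun _ => rfl
  have c1 : ∀ x : Icc (0 : ℝ) 1, contRep (sobolevDeriv W) x = w' x := fun x => by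
    rw [contRep_eq_add_integral, hW1]
    exact key x.2 h2 hc a2
  have a1 := hae (isContRep_contRep (sobolevDeriv W)) c1
  have c0 : ∀ x : Icc (0 : ℝ) 1, contRep (sobolevIncl W) x = w x := fun x => by
    rw [contRep_eq_add_integral, hW0]
    exact key x.2 h1 hc' a1
  exact ⟨W, c0, c1, hae (isContRep_contRep (sobolevIncl W)) c0, a2⟩

/-- Hermite interpolation: the four traces of `H²(0,1)` can be prescribed. -/
theorem exists_sobolevH2_traces (a₀ a₁ b₀ b₁ : ℂ) :
    ∃ w : sobolevH2, contRep (sobolevIncl w) 0 = a₀ ∧ contRep (sobolevIncl w) 1 = a₁ ∧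
      contRep (sobolevDeriv w) 0 = b₀ ∧ contRep (sobolevDeriv w) 1 = b₁ := by
  -- In the cubic `a₀ + b₀x + cx² + dx³` the conditions at `1` are `c + d = a₁ - a₀ - b₀` and `2c +
  -- 3d = b₁ - b₀`.
  set c : ℂ := 3 * (a₁ - a₀) - 2 * b₀ - b₁ with hc
  set d : ℂ := b₀ + b₁ - 2 * (a₁ - a₀) with hd
  have hx : ∀ x : ℝ, HasDerivAt (fun x : ℝ => (x : ℂ)) 1 x := fun x => Complex.ofRealCLM.hasDerivAt
  obtain ⟨w, h0, h1, -, -⟩ := exists_sobolevH2_of_hasDerivAt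
    (w := fun x => a₀ + b₀ * x + c * (x : ℂ) ^ 2 + d * (x : ℂ) ^ 3)
    (w' := fun x => b₀ + 2 * c * x + 3 * d * (x : ℂ) ^ 2)
    (w'' := fun x => 2 * c + 6 * d * x)
    (fun x => by
      have := (((hx x).const_mul b₀).const_add a₀).add (((hx x).pow 2).const_mul c) |>.add
        (((hx x).pow 3).const_mul d)
      refine this.congr_deriv ?_
      push_cast; ring)
    (fun x => by
      have := (((hx x).const_mul (2 * c)).const_add b₀).add (((hx x).pow 2).const_mul (3 * d))
      refine this.congr_deriv ?_
      push_cast; ring)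
    (by fun_prop)
  refine ⟨w, ?_, ?_, ?_, ?_⟩
  · rw [h0]; simp
  · rw [h0]; simp [hc, hd]; ring
  · rw [h1]; simp
  · rw [h1]; simp [hc, hd]; ring

/-- Green's second identity. -/
theorem inner_sub_inner_eq_traces (v w : sobolevH2) :
    inner ℂ (v : L2Unit) (weakDeriv (sobolevDeriv w)) -
      inner ℂ (weakDeriv (sobolevDeriv v)) (w : L2Unit) =
      (starRingEnd ℂ (contRep (sobolevIncl v) 1) * contRep (sobolevDeriv w) 1 -
        starRingEnd ℂ (contRep (sobolevIncl v) 0) * contRep (sobolevDeriv w) 0) -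
      (starRingEnd ℂ (contRep (sobolevDeriv v) 1) * contRep (sobolevIncl w) 1 -
        starRingEnd ℂ (contRep (sobolevDeriv v) 0) * contRep (sobolevIncl w) 0) := by
  have h1 := inner_weakDeriv_add (sobolevIncl v) (sobolevDeriv w)
  have h2 := inner_weakDeriv_add (sobolevDeriv v) (sobolevIncl w)
  rw [weakDeriv_sobolevIncl] at h1 h2
  change _ + inner ℂ (v : L2Unit) _ = _ at h1
  change inner ℂ _ (w : L2Unit) + _ = _ at h2
  linear_combination h1 - h2

/-- Each linear combination of the traces is bounded by the graph norm of `w ↦ w''`. -/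
theorem exists_norm_trace_le (a₀ a₁ b₀ b₁ : ℂ) :
    ∃ C : ℝ, 0 ≤ C ∧ ∀ w : sobolevH2,
      ‖a₀ * contRep (sobolevIncl w) 0 + a₁ * contRep (sobolevIncl w) 1 +
        b₀ * contRep (sobolevDeriv w) 0 + b₁ * contRep (sobolevDeriv w) 1‖ ≤
      C * (‖(w : L2Unit)‖ + ‖weakDeriv (sobolevDeriv w)‖) := by
  -- The traces of `v` are chosen so that the boundary terms of Green's second identity for `v` and
  -- `w` are exactly the given combination; Cauchy–Schwarz then bounds it.
  obtain ⟨v, h1, h2, h3, h4⟩ := exists_sobolevH2_traces (-starRingEnd ℂ b₀) (starRingEnd ℂ b₁)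
    (starRingEnd ℂ a₀) (-starRingEnd ℂ a₁)
  refine ⟨‖(v : L2Unit)‖ + ‖weakDeriv (sobolevDeriv v)‖, by positivity, fun w => ?_⟩
  have h := inner_sub_inner_eq_traces v w
  rw [h1, h2, h3, h4] at h
  simp only [map_neg, RingHomCompTriple.comp_apply, RingHom.id_apply] at h
  have e : a₀ * contRep (sobolevIncl w) 0 + a₁ * contRep (sobolevIncl w) 1 +
        b₀ * contRep (sobolevDeriv w) 0 + b₁ * contRep (sobolevDeriv w) 1 =
      inner ℂ (v : L2Unit) (weakDeriv (sobolevDeriv w)) -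
        inner ℂ (weakDeriv (sobolevDeriv v)) (w : L2Unit) := by
    rw [h]; ring
  rw [e]
  refine (norm_sub_le _ _).trans ?_
  have i1 := norm_inner_le_norm (𝕜 := ℂ) (v : L2Unit) (weakDeriv (sobolevDeriv w))
  have i2 := norm_inner_le_norm (𝕜 := ℂ) (weakDeriv (sobolevDeriv v)) (w : L2Unit)
  nlinarith [mul_nonneg (norm_nonneg (v : L2Unit)) (norm_nonneg (w : L2Unit)),
    mul_nonneg (norm_nonneg (weakDeriv (sobolevDeriv v))) (norm_nonneg (weakDeriv (sobolevDeriv w)))]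

end SobolevTraces

/-! ### The heat equation as a boundary node -/

section HeatNode

variable {β : ℝ}

theorem heatL_apply (w : sobolevH2) :
    heatL β w = (β : ℂ) • weakDeriv (sobolevDeriv w) := rfl

theorem heatG_apply (w : sobolevH2) :
    heatG β w = !₂[contRep (sobolevIncl w) 0, contRep (sobolevIncl w) 1] := rfl

theorem heatK_apply (w : sobolevH2) :
    heatK β w = !₂[-(β : ℂ) * contRep (sobolevDeriv w) 0, (β : ℂ) * contRep (sobolevDeriv w) 1] :=
  rfl

theorem heatG_eq_zero_iff (w : sobolevH2) :
    heatG β w = 0 ↔ contRep (sobolevIncl w) 0 = 0 ∧ contRep (sobolevIncl w) 1 = 0 := by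
  rw [heatG_apply]
  constructor
  · intro h
    exact ⟨by simpa using congr($h 0), by simpa using congr($h 1)⟩
  · rintro ⟨h0, h1⟩
    ext i; fin_cases i <;> simp [h0, h1]

/-- The energy identity. -/
theorem inner_heatL_self (w : sobolevH2) :
    (inner ℂ (heatL β w) (w : L2Unit)).re =
      (inner ℂ (heatG β w) (heatK β w)).re - β * ‖(sobolevDeriv w : L2Unit)‖ ^ 2 := by
  have h := inner_weakDeriv_add (sobolevDeriv w) (sobolevIncl w)
  rw [weakDeriv_sobolevIncl, inner_self_eq_norm_sq_to_K] at h
  change inner ℂ _ (w : L2Unit) + _ = _ at h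
  rw [heatL_apply, heatG_apply, heatK_apply, inner_smul_left, eq_sub_of_add_eq h]
  simp only [PiLp.inner_apply, Fin.sum_univ_two, RCLike.inner_apply]
  simp [← Complex.ofReal_pow]
  ring

theorem isImpedancePassive_heat (hβ : 0 ≤ β) :
    IsImpedancePassive (heatL β) (heatG β) (heatK β) := by
  intro w
  rw [inner_heatL_self (β := β) w]
  have : 0 ≤ β * ‖(sobolevDeriv w : L2Unit)‖ ^ 2 := by positivity
  linarith

theorem surjective_heatG_heatK (hβ : β ≠ 0) :
    Function.Surjective (fun w : (heatL β).domain => (heatG β w, heatK β w)) := by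
  rintro ⟨u, v⟩
  obtain ⟨w, h1, h2, h3, h4⟩ := exists_sobolevH2_traces (u 0) (u 1) (-v 0 / β) (v 1 / β)
  have hβ' : (β : ℂ) ≠ 0 := by exact_mod_cast hβ
  refine ⟨w, Prod.ext ?_ ?_⟩
  · change heatG β w = u
    rw [heatG_apply, h1, h2]
    ext i; fin_cases i <;> simp
  · change heatK β w = v
    rw [heatK_apply, h3, h4]
    ext i; fin_cases i <;> simp <;> field_simp

theorem norm_add_norm_le_graphNorm (hβ : 0 < β) (w : sobolevH2) :
    ‖(w : L2Unit)‖ + ‖weakDeriv (sobolevDeriv w)‖ ≤ (1 + β⁻¹) * graphNorm (heatL β) w := by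
  have h : ‖heatL β w‖ = β * ‖weakDeriv (sobolevDeriv w)‖ := by
    rw [heatL_apply, norm_smul, Complex.norm_of_nonneg hβ.le]
  have e : graphNorm (heatL β) w = ‖(w : L2Unit)‖ + ‖heatL β w‖ := rfl
  have h2 : ‖weakDeriv (sobolevDeriv w)‖ = β⁻¹ * ‖heatL β w‖ := by
    rw [h]; field_simp
  rw [e, h2]
  have h3 : 0 ≤ β⁻¹ * ‖(w : L2Unit)‖ := by positivity
  nlinarith [norm_nonneg (heatL β w)]

theorem exists_norm_pair_le (hβ : 0 < β) {f : (heatL β).domain →ₗ[ℂ] EuclideanSpace ℂ (Fin 2)}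
    (hf : ∀ i, ∃ a₀ a₁ b₀ b₁ : ℂ, ∀ w : sobolevH2,
      f w i = a₀ * contRep (sobolevIncl w) 0 + a₁ * contRep (sobolevIncl w) 1 +
        b₀ * contRep (sobolevDeriv w) 0 + b₁ * contRep (sobolevDeriv w) 1) :
    ∃ C : ℝ, ∀ w, ‖f w‖ ≤ C * graphNorm (heatL β) w := by
  have hi : ∀ i, ∃ C : ℝ, ∀ w, ‖f w i‖ ≤ C * graphNorm (heatL β) w := fun i => by
    obtain ⟨a₀, a₁, b₀, b₁, h⟩ := hf i
    obtain ⟨C, hC0, hC⟩ := exists_norm_trace_le a₀ a₁ b₀ b₁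
    refine ⟨C * (1 + β⁻¹), fun w => ?_⟩
    rw [h w, mul_assoc]
    exact (hC w).trans (mul_le_mul_of_nonneg_left (norm_add_norm_le_graphNorm hβ w) hC0)
  choose C hC using hi
  refine ⟨C 0 + C 1, fun w => ?_⟩
  have h1 : f w = EuclideanSpace.single 0 (f w 0) + EuclideanSpace.single 1 (f w 1) := by
    ext i; fin_cases i <;> simp
  rw [h1]
  refine (norm_add_le _ _).trans ?_
  rw [PiLp.norm_single, PiLp.norm_single, add_mul]
  exact add_le_add (hC 0 w) (hC 1 w)

theorem exists_heatG_rightInverse :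
    ∃ Gr : EuclideanSpace ℂ (Fin 2) →ₗ[ℂ] (heatL β).domain,
      (∃ C : ℝ, ∀ u, graphNorm (heatL β) (Gr u) ≤ C * ‖u‖) ∧ ∀ u, heatG β (Gr u) = u := by
  obtain ⟨e₀, h00, h01, -, -⟩ := exists_sobolevH2_traces 1 0 0 0
  obtain ⟨e₁, h10, h11, -, -⟩ := exists_sobolevH2_traces 0 1 0 0
  let p : Fin 2 → EuclideanSpace ℂ (Fin 2) →ₗ[ℂ] ℂ := fun i =>
    (EuclideanSpace.proj (𝕜 := ℂ) i).toLinearMap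
  let Gr : EuclideanSpace ℂ (Fin 2) →ₗ[ℂ] (heatL β).domain :=
    (p 0).smulRight (e₀ : (heatL β).domain) + (p 1).smulRight (e₁ : (heatL β).domain)
  -- Linear maps on the finite-dimensional `ℂ²` are automatically bounded, which gives both halves
  -- of the graph norm estimate.
  let P : EuclideanSpace ℂ (Fin 2) →L[ℂ] L2Unit :=
    LinearMap.toContinuousLinearMap ((heatL β).domain.subtype ∘ₗ Gr)
  let Q : EuclideanSpace ℂ (Fin 2) →L[ℂ] L2Unit :=
    LinearMap.toContinuousLinearMap ((heatL β).toFun ∘ₗ Gr)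
  refine ⟨Gr, ⟨‖P‖ + ‖Q‖, fun u => ?_⟩, fun u => ?_⟩
  · rw [add_mul]
    exact add_le_add (P.le_opNorm u) (Q.le_opNorm u)
  · have h0 : heatG β e₀ = !₂[1, 0] := by rw [heatG_apply, h00, h01]
    have h1 : heatG β e₁ = !₂[0, 1] := by rw [heatG_apply, h10, h11]
    have h : heatG β (Gr u) = u 0 • heatG β e₀ + u 1 • heatG β e₁ := by
      refine (map_add (heatG β) _ _).trans ?_
      exact congrArg₂ (· + ·) (map_smul (heatG β) _ _) (map_smul (heatG β) _ _)
    rw [h, h0, h1]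
    ext i; fin_cases i <;> simp

/-- The operator `-L` on `ker G`. -/
def negDirichlet (β : ℝ) : LinearMap.ker (heatG β) →ₗ[ℂ] L2Unit :=
  -((heatL β).toFun ∘ₗ (LinearMap.ker (heatG β)).subtype)

theorem negDirichlet_apply (w : LinearMap.ker (heatG β)) :
    negDirichlet β w = -heatL β w := rfl

theorem inner_negDirichlet_self_re (w : LinearMap.ker (heatG β)) :
    (inner ℂ (negDirichlet β w) ((w : (heatL β).domain) : L2Unit)).re =
      β * ‖(sobolevDeriv (w : (heatL β).domain) : L2Unit)‖ ^ 2 := by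
  have h := inner_heatL_self (β := β) (w : (heatL β).domain)
  have hw : heatG β w = 0 := w.2
  rw [hw, inner_zero_left, Complex.zero_re, zero_sub] at h
  rw [negDirichlet_apply, inner_neg_left, Complex.neg_re, h, neg_neg]

theorem inner_negDirichlet_comm (v w : LinearMap.ker (heatG β)) :
    inner ℂ (negDirichlet β v) ((w : (heatL β).domain) : L2Unit) =
      inner ℂ ((v : (heatL β).domain) : L2Unit) (negDirichlet β w) := by
  obtain ⟨hv0, hv1⟩ := (heatG_eq_zero_iff (β := β) (v : (heatL β).domain)).1 v.2
  obtain ⟨hw0, hw1⟩ := (heatG_eq_zero_iff (β := β) (w : (heatL β).domain)).1 w.2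
  have h := inner_sub_inner_eq_traces (v : (heatL β).domain) (w : (heatL β).domain)
  rw [hv0, hv1, hw0, hw1] at h
  simp only [map_zero, zero_mul, mul_zero, sub_zero] at h
  rw [negDirichlet_apply, negDirichlet_apply, heatL_apply (w : (heatL β).domain),
    heatL_apply (v : (heatL β).domain), inner_neg_left, inner_neg_right, inner_smul_left,
    inner_smul_right, Complex.conj_ofReal, ← sub_eq_zero.1 h]

/-- Injectivity: the energy identity forces `w' = 0`, and `w(0) = 0`. Surjectivity: the double
primitive `w₀` of `-f/β` with zero initial data is corrected to `w₀ - w₀(1) x`, which has the same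
second derivative. -/
theorem bijective_negDirichlet (hβ : 0 < β) : Function.Bijective (negDirichlet β) := by
  constructor
  · rw [← LinearMap.ker_eq_bot, LinearMap.ker_eq_bot']
    intro w hw
    have h := inner_negDirichlet_self_re w
    rw [hw, inner_zero_left, Complex.zero_re] at h
    have h1 : (sobolevDeriv (w : (heatL β).domain) : L2Unit) = 0 := by
      have h2 : ‖(sobolevDeriv (w : (heatL β).domain) : L2Unit)‖ ^ 2 = 0 := by
        rcases mul_eq_zero.1 h.symm with h | h
        · exact absurd h hβ.ne'
        · exact h
      simpa using h2
    have h2 : sobolevIncl (w : (heatL β).domain) = 0 := by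
      refine sobolevH1_ext ?_ ?_
      · refine ((heatG_eq_zero_iff (β := β) (w : (heatL β).domain)).1 w.2).1.trans ?_
        rw [map_zero contRep]; rfl
      · exact h1.trans (map_zero weakDeriv).symm
    have h3 := sobolevIncl_injective (h2.trans (map_zero sobolevIncl).symm)
    exact Subtype.ext h3
  · intro f
    obtain ⟨w₀, h00, -, h02⟩ := exists_sobolevH2_primitive 0 0 (-(β : ℂ)⁻¹ • f)
    obtain ⟨l, hl, -, -, hl2⟩ := exists_sobolevH2_of_hasDerivAt (w := fun x => (x : ℂ))
      (w' := fun _ => 1) (w'' := fun _ => 0) (fun x => Complex.ofRealCLM.hasDerivAt)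
      (fun x => hasDerivAt_const x 1) continuous_const
    have hl2' : weakDeriv (sobolevDeriv l) = 0 := by
      refine Lp.ext ?_
      filter_upwards [hl2, Lp.coeFn_zero ℂ 2 (volume.restrict (Ioo (0 : ℝ) 1))] with x a b
      rw [a, b]; rfl
    set c := contRep (sobolevIncl w₀) 1 with hc
    let w : sobolevH2 := w₀ - c • l
    have ew : ∀ x, contRep (sobolevIncl w) x =
        contRep (sobolevIncl w₀) x - c * contRep (sobolevIncl l) x := fun x => by
      have : contRep (sobolevIncl w) = contRep (sobolevIncl w₀) - c • contRep (sobolevIncl l) := by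
        rw [← map_smul contRep, ← map_smul sobolevIncl, ← map_sub contRep, ← map_sub sobolevIncl]
      rw [this]; rfl
    have hw : heatG β w = 0 := by
      rw [heatG_eq_zero_iff, ew, ew, hl, hl, h00]
      simp [← hc]
    refine ⟨⟨w, hw⟩, ?_⟩
    have hβ' : (β : ℂ) ≠ 0 := by exact_mod_cast hβ.ne'
    have e : weakDeriv (sobolevDeriv w) = -(β : ℂ)⁻¹ • f := by
      rw [map_sub sobolevDeriv, map_smul sobolevDeriv, map_sub weakDeriv, map_smul weakDeriv, h02,
        hl2', smul_zero, sub_zero]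
    change -((β : ℂ) • weakDeriv (sobolevDeriv w)) = f
    rw [e, neg_smul, smul_neg, neg_neg, smul_smul, mul_inv_cancel₀ hβ', one_smul]

end HeatNode

/-! ### The Dirichlet solution operator and the heat semigroup -/

section HeatSemigroup

variable {β : ℝ}

/-- The solution operator of the Dirichlet problem `-β w'' = f`, `w(0) = w(1) = 0`. -/
def dirichletSolve (hβ : 0 < β) : L2Unit →ₗ[ℂ] L2Unit :=
  ((heatL β).domain.subtype ∘ₗ (LinearMap.ker (heatG β)).subtype) ∘ₗ
    (LinearEquiv.ofBijective (negDirichlet β) (bijective_negDirichlet hβ)).symm.toLinearMap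

theorem dirichletSolve_negDirichlet (hβ : 0 < β) (w : LinearMap.ker (heatG β)) :
    dirichletSolve hβ (negDirichlet β w) = ((w : (heatL β).domain) : L2Unit) := by
  have h : (LinearEquiv.ofBijective (negDirichlet β) (bijective_negDirichlet hβ)).symm
      (negDirichlet β w) = w :=
    LinearEquiv.ofBijective_symm_apply_apply _ w
  change (((LinearEquiv.ofBijective (negDirichlet β) (bijective_negDirichlet hβ)).symm
      (negDirichlet β w) : (heatL β).domain) : L2Unit) = _
  rw [h]

theorem isSymmetric_dirichletSolve (hβ : 0 < β) : (dirichletSolve hβ).IsSymmetric := by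
  intro f g
  obtain ⟨v, rfl⟩ := (bijective_negDirichlet hβ).2 f
  obtain ⟨w, rfl⟩ := (bijective_negDirichlet hβ).2 g
  rw [dirichletSolve_negDirichlet, dirichletSolve_negDirichlet, inner_negDirichlet_comm]

/-- The solution operator of the Dirichlet problem as a bounded operator on `L²(0,1)`. -/
def dirichletInv (hβ : 0 < β) : L2Unit →L[ℂ] L2Unit :=
  -- Hellinger–Toeplitz: an everywhere defined symmetric operator is bounded, so no a priori
  -- estimate for the Dirichlet problem is needed.
  ⟨dirichletSolve hβ, (isSymmetric_dirichletSolve hβ).continuous⟩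

theorem dirichletInv_negDirichlet (hβ : 0 < β) (w : LinearMap.ker (heatG β)) :
    dirichletInv hβ (negDirichlet β w) = ((w : (heatL β).domain) : L2Unit) :=
  dirichletSolve_negDirichlet hβ w

/-- For `f = -Lw` with `w ∈ Ker G`, the quadratic form of the solution operator at `f` is the energy
`β‖w'‖²`. -/
theorem dirichletInv_nonneg (hβ : 0 < β) : 0 ≤ dirichletInv hβ := by
  rw [ContinuousLinearMap.nonneg_iff_isPositive]
  refine ⟨isSymmetric_dirichletSolve hβ, fun f => ?_⟩
  obtain ⟨w, rfl⟩ := (bijective_negDirichlet hβ).2 f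
  rw [ContinuousLinearMap.reApplyInnerSelf_apply, dirichletInv_negDirichlet, inner_re_symm]
  refine le_of_le_of_eq ?_ (inner_negDirichlet_self_re w).symm
  positivity

theorem dirichletInv_injective (hβ : 0 < β) : Function.Injective (dirichletInv hβ) := by
  intro f g h
  obtain ⟨v, rfl⟩ := (bijective_negDirichlet hβ).2 f
  obtain ⟨w, rfl⟩ := (bijective_negDirichlet hβ).2 g
  rw [dirichletInv_negDirichlet, dirichletInv_negDirichlet] at h
  rw [Subtype.ext (Subtype.ext h)]

theorem restrictKer_heat_iff (hβ : 0 < β) (x y : L2Unit) :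
    (∃ h : x ∈ (restrictKer (heatL β) (heatG β)).domain,
      restrictKer (heatL β) (heatG β) ⟨x, h⟩ = y) ↔ x = -dirichletInv hβ y := by
  constructor
  · rintro ⟨h, hy⟩
    obtain ⟨w, hw, hwx⟩ := h.1
    have h1 : restrictKer (heatL β) (heatG β) ⟨x, h⟩ = heatL β w :=
      LinearPMap.domRestrict_apply (f := heatL β) hwx.symm
    have h2 := dirichletInv_negDirichlet hβ ⟨w, hw⟩
    rw [negDirichlet_apply, map_neg] at h2
    rw [← hy, h1, h2]
    exact hwx.symm
  · rintro rfl
    obtain ⟨w, hw⟩ := (bijective_negDirichlet hβ).2 (-y)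
    have hx : -dirichletInv hβ y = ((w : (heatL β).domain) : L2Unit) := by
      rw [← map_neg, ← hw, dirichletInv_negDirichlet]
    rw [hx]
    refine ⟨⟨⟨w, w.2, rfl⟩, w.1.2⟩, ?_⟩
    rw [negDirichlet_apply, neg_inj] at hw
    rw [← hw]
    exact LinearPMap.domRestrict_apply (f := heatL β) rfl

/-- The semigroup of the heat equation with Dirichlet boundary conditions. -/
def heatSemigroup (hβ : 0 < β) : C0Semigroup L2Unit :=
  negInvSemigroup (dirichletInv hβ) (dirichletInv_nonneg hβ) (dirichletInv_injective hβ)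

theorem heatSemigroup_isGeneratedBy (hβ : 0 < β) :
    (heatSemigroup hβ).IsGeneratedBy (restrictKer (heatL β) (heatG β)) :=
  isGeneratedBy_negInvSemigroup _ _ (restrictKer_heat_iff hβ)

theorem isBoundaryNode_heat (hβ : 0 < β) :
    IsBoundaryNode (heatL β) (heatG β) (heatK β) where
  bounded_G := by
    refine exists_norm_pair_le hβ (Fin.forall_fin_two.2 ⟨⟨1, 0, 0, 0, fun w => ?_⟩,
      ⟨0, 1, 0, 0, fun w => ?_⟩⟩)
    · rw [heatG_apply]; simp
    · rw [heatG_apply]; simp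
  bounded_K := by
    refine exists_norm_pair_le hβ (Fin.forall_fin_two.2 ⟨⟨0, 0, -β, 0, fun w => ?_⟩,
      ⟨0, 0, 0, β, fun w => ?_⟩⟩)
    · rw [heatK_apply]; simp
    · rw [heatK_apply]; simp
  generates := ⟨_, heatSemigroup_isGeneratedBy hβ⟩
  rightInverse := exists_heatG_rightInverse

end HeatSemigroup

/-! ### The transfer function -/

section HeatTransfer

variable {β : ℝ}

theorem Complex.sqrt_mul_self (z : ℂ) : Complex.sqrt z * Complex.sqrt z = z := by
  have := Complex.cpow_nat_inv_pow z (n := 2) two_ne_zero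
  rw [← sq]
  exact this

theorem Complex.sqrt_re_pos {z : ℂ} (hz : 0 ≤ z.re) (hz0 : z ≠ 0) : 0 < (Complex.sqrt z).re := by
  rw [Complex.sqrt, Complex.cpow_inv_two_re]
  have : 0 < ‖z‖ := norm_pos_iff.2 hz0
  positivity

/-- A zero would give `e^s = e^{-s}`, but the moduli `e^{Re s}` and `e^{-Re s}` differ. -/
theorem Complex.sinh_ne_zero_of_re_pos {s : ℂ} (hs : 0 < s.re) : Complex.sinh s ≠ 0 := by
  intro h
  have h1 : Complex.exp s = Complex.exp (-s) := by
    rw [Complex.sinh, div_eq_zero_iff, sub_eq_zero] at h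
    exact h.resolve_right two_ne_zero
  have h2 := congrArg (fun z => ‖z‖) h1
  simp only [Complex.norm_exp, Complex.neg_re, Real.exp_eq_exp] at h2
  linarith

/-- Both sides square to `zβ` and have positive real part, so they cannot be opposite roots. This
reconciles the two square roots in `heatP1` and `heatP2`. -/
theorem sqrt_mul_ofReal (hβ : 0 < β) {z : ℂ} (hz : 0 ≤ z.re) (hz0 : z ≠ 0) :
    Complex.sqrt (z * β) = β * Complex.sqrt (z / β) := by
  have hβ' : (β : ℂ) ≠ 0 := by exact_mod_cast hβ.ne'
  have h1 := Complex.sqrt_mul_self (z * β)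
  have h2 := Complex.sqrt_mul_self (z / β)
  have p1 : 0 < (Complex.sqrt (z * β)).re :=
    Complex.sqrt_re_pos (by rw [Complex.re_mul_ofReal]; positivity) (mul_ne_zero hz0 hβ')
  have p2 : 0 < (Complex.sqrt (z / β)).re :=
    Complex.sqrt_re_pos (by rw [Complex.div_ofReal_re]; positivity) (div_ne_zero hz0 hβ')
  have h3 : z = β * (z / β) := by field_simp
  have h : (Complex.sqrt (z * β) - β * Complex.sqrt (z / β)) *
      (Complex.sqrt (z * β) + β * Complex.sqrt (z / β)) = 0 := by
    linear_combination h1 - (β : ℂ) ^ 2 * h2 + (β : ℂ) * h3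
  rcases mul_eq_zero.1 h with h | h
  · exact sub_eq_zero.1 h
  · have := congrArg Complex.re h
    rw [Complex.add_re, Complex.re_ofReal_mul, Complex.zero_re] at this
    nlinarith

/-- The solution of `(z - L) w = 0`, `G w = u`, and its image under `K`. -/
theorem exists_elliptic_solution (hβ : 0 < β) {z : ℂ} (hz : 0 ≤ z.re)
    (u : EuclideanSpace ℂ (Fin 2)) :
    ∃ w : sobolevH2, z • (w : L2Unit) - heatL β w = 0 ∧ heatG β w = u ∧
      heatK β w = !₂[heatP1 β z * u 0 + heatP2 β z * u 1, heatP2 β z * u 0 + heatP1 β z * u 1] := by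
  have hβ' : (β : ℂ) ≠ 0 := by exact_mod_cast hβ.ne'
  have solves : ∀ {w : sobolevH2} {f f'' : ℝ → ℂ},
      (∀ᵐ x ∂volume.restrict (Ioo (0 : ℝ) 1), (w : L2Unit) x = f x) →
      (∀ᵐ x ∂volume.restrict (Ioo (0 : ℝ) 1), weakDeriv (sobolevDeriv w) x = f'' x) →
      (∀ x, z * f x = β * f'' x) → z • (w : L2Unit) - heatL β w = 0 := by
    intro w f f'' h1 h2 h
    rw [sub_eq_zero, heatL_apply]
    refine Lp.ext ?_
    filter_upwards [h1, h2, Lp.coeFn_smul z (w : L2Unit),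
      Lp.coeFn_smul (β : ℂ) (weakDeriv (sobolevDeriv w))] with x a b c d
    rw [c, d, Pi.smul_apply, Pi.smul_apply, a, b, smul_eq_mul, smul_eq_mul, h]
  have hx : ∀ x : ℝ, HasDerivAt (fun x : ℝ => (x : ℂ)) 1 x := fun x => Complex.ofRealCLM.hasDerivAt
  rcases eq_or_ne z 0 with rfl | hz0
  · obtain ⟨w, h0, h1, a0, a2⟩ := exists_sobolevH2_of_hasDerivAt
      (w := fun x => u 0 + (u 1 - u 0) * x) (w' := fun _ => u 1 - u 0) (w'' := fun _ => 0)
      (fun x => (((hx x).const_mul (u 1 - u 0)).const_add (u 0)).congr_deriv (by simp))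
      (fun x => hasDerivAt_const x _) continuous_const
    refine ⟨w, solves a0 a2 (by simp), ?_, ?_⟩
    · rw [heatG_apply, h0, h0]
      ext i; fin_cases i <;> simp
    · rw [heatK_apply, h1, h1]
      ext i; fin_cases i <;> simp [heatP1, heatP2] <;> ring
  · set s := Complex.sqrt (z / β) with hs
    have hre : 0 < s.re :=
      Complex.sqrt_re_pos (by rw [Complex.div_ofReal_re]; positivity) (div_ne_zero hz0 hβ')
    have hss : s * s = z / β := Complex.sqrt_mul_self _
    have hsinh : Complex.sinh s ≠ 0 := Complex.sinh_ne_zero_of_re_pos hre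
    have hl : ∀ ζ : ℂ, HasDerivAt (fun ζ : ℂ => s * ζ) s ζ := fun ζ =>
      ((hasDerivAt_id ζ).const_mul s).congr_deriv (by simp)
    have hr : ∀ ζ : ℂ, HasDerivAt (fun ζ : ℂ => s * (1 - ζ)) (-s) ζ := fun ζ =>
      (((hasDerivAt_id ζ).const_sub 1).const_mul s).congr_deriv (by simp)
    -- The functions `sinh(s(1 - x))/sinh s` and `sinh(sx)/sinh s` solve `w'' = s²w` and take the
    -- boundary values `(1, 0)` and `(0, 1)`.
    obtain ⟨w, h0, h1, a0, a2⟩ := exists_sobolevH2_of_hasDerivAt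
      (w := fun x => u 0 / Complex.sinh s * Complex.sinh (s * (1 - (x : ℂ))) +
        u 1 / Complex.sinh s * Complex.sinh (s * x))
      (w' := fun x => u 0 / Complex.sinh s * (Complex.cosh (s * (1 - (x : ℂ))) * -s) +
        u 1 / Complex.sinh s * (Complex.cosh (s * x) * s))
      (w'' := fun x => s * s * (u 0 / Complex.sinh s * Complex.sinh (s * (1 - (x : ℂ))) +
        u 1 / Complex.sinh s * Complex.sinh (s * x)))
      (fun x => (((hr x).csinh.const_mul (u 0 / Complex.sinh s)).add
        ((hl x).csinh.const_mul (u 1 / Complex.sinh s))).comp_ofReal)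
      (fun x => ((((hr x).ccosh.mul_const (-s)).const_mul (u 0 / Complex.sinh s)).add
        (((hl x).ccosh.mul_const s).const_mul (u 1 / Complex.sinh s))).comp_ofReal.congr_deriv
        (by ring))
      (by fun_prop)
    refine ⟨w, solves a0 a2 fun x => ?_, ?_, ?_⟩
    · rw [hss]; field_simp
    · rw [heatG_apply, h0, h0]
      ext i; fin_cases i <;> simp [hsinh]
    · rw [heatK_apply, h1, h1, heatP1, heatP2, if_neg hz0, if_neg hz0,
        sqrt_mul_ofReal hβ hz hz0, ← hs, Complex.tanh_eq_sinh_div_cosh, div_div_eq_mul_div]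
      ext i; fin_cases i <;> simp <;> field_simp <;> ring

theorem transferFunction_heat (hβ : 0 < β)
    (hnode : IsBoundaryNode (heatL β) (heatG β) (heatK β)) {z : ℂ} (hz : 0 ≤ z.re)
    (hmem : z ∈ operatorResolventSet (restrictKer (heatL β) (heatG β))) :
    hnode.transferFunction ⟨z, hmem⟩ = Matrix.toEuclideanCLM (n := Fin 2) (𝕜 := ℂ)
      !![heatP1 β z, heatP2 β z; heatP2 β z, heatP1 β z] := by
  ext1 u
  obtain ⟨w, h1, h2, h3⟩ := exists_elliptic_solution hβ hz u
  rw [hnode.transferFunction_apply ⟨z, hmem⟩ u w h1 h2]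
  refine h3.trans ?_
  ext i
  fin_cases i <;> simp [Matrix.mulVec, dotProduct, Fin.sum_univ_two]

end HeatTransfer

end

theorem lemma3p1 (β : ℝ) (hβ : 0 < β) :
    -- `(G, L, K)` is an impedance passive boundary node
    ∃ hnode : IsBoundaryNode (heatL β) (heatG β) (heatK β),
      IsImpedancePassive (heatL β) (heatG β) (heatK β) ∧
      -- the semigroup generated by `A` is uniformly exponentially stable
      (∃ T : C0Semigroup L2Unit, T.IsGeneratedBy (restrictKer (heatL β) (heatG β)) ∧
        T.IsUniformlyExponentiallyStable) ∧
      -- `w ↦ (G w, K w)` maps `D(L)` onto `ℂ² × ℂ²`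
      Function.Surjective (fun w : (heatL β).domain => (heatG β w, heatK β w)) ∧
      -- the transfer function on the closed right half-plane, which lies in `ρ(A)`
      ∀ z : ℂ, 0 ≤ z.re →
        ∃ hz : z ∈ operatorResolventSet (restrictKer (heatL β) (heatG β)),
          hnode.transferFunction ⟨z, hz⟩ =
            Matrix.toEuclideanCLM (n := Fin 2) (𝕜 := ℂ)
              !![heatP1 β z, heatP2 β z; heatP2 β z, heatP1 β z] := by

  refine ⟨isBoundaryNode_heat hβ, isImpedancePassive_heat hβ.le,
    ⟨heatSemigroup hβ, heatSemigroup_isGeneratedBy hβ,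
      isUniformlyExponentiallyStable_negInvSemigroup _ _⟩,
    surjective_heatG_heatK hβ.ne', fun z hz => ?_⟩
  have hmem := mem_operatorResolventSet_of_negInv (dirichletInv_nonneg hβ)
    (restrictKer_heat_iff hβ) hz
  exact ⟨hmem, transferFunction_heat hβ _ hz hmem⟩
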